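/- Let $K$ be a compact Lie group with Lie algebra $\mathfrak k$, let $T\subset K$ be a maximal torus with Lie algebra $\mathfrak t$, and put $\mathfrak g=\mathfrak k\otimes\mathbb C$, $\mathfrak h=\mathfrak t\otimes\mathbb C$. Let $\Delta\subset\mathfrak h^*$ be the set of roots, $\mathfrak g_\alpha$ ($\alpha\in\Delta$) the root spaces, $\Delta^+$ a system of positive roots, and let $\langle\cdot,\cdot\rangle$ be the form on the span of $\Delta$ transferred from the Killing form of $\mathfrak g$. For each $\alpha\in\Delta^+$ choose $e_\alpha\in\mathfrak g_\alpha$ and $f_\alpha\in\mathfrak g_{-\alpha}$ such that $[e_\alpha,f_\alpha]=h_\alpha\in\mathfrak h$ is the coroot of $\alpha$ (so $\alpha(h_\alpha)=2$) and such that $e_\alpha-f_\alpha$ and $i(e_\alpha+f_\alpha)$ belong to $\mathfrak k$. Let $V$ be a finite-dimensional irreducible unitary complex representation of $K$, regarded also as a representation of $\mathfrak g$, and let $p\in V$ be a unit highest weight vector, that is, a unit weight vector for $\mathfrak h$ that is annihilated by $\mathfrak g_\alpha$ for all $\alpha\in\Delta^+$. Let $M=Kp$ be the orbit of $p$ in the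 unit sphere of $V$, let $T_pM$ be its tangent space at $p$ and $\nu_pM$ its normal space at $p$ in the unit sphere, and let $\mathrm{II}_p:T_pM\times T_pM\to\nu_pM$ be its second fundamental form at $p$ in the unit sphere. Then for all $\alpha,\beta\in\Delta^+$ the vectors $f_\alpha p$ and $f_\beta p$ are tangent to $M$ at $p$, and $$\|\mathrm{II}_p(f_\alpha p,f_\beta p)\|\le m_{\alpha,\beta}\,\|f_\alpha p\|\,\|f_\beta p\|,$$ where $m_{\alpha,\beta}=\sqrt2$ if $\alpha=\beta$ or $\langle\alpha,\beta\rangle<0$, and $m_{\alpha,\beta}=1$ otherwise. -/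

import Mathlib

open scoped Manifold ContDiff TensorProduct

attribute [local instance] InnerProductSpace.complexToReal

/-- A smooth real Lie group has the regularity that Mathlib asks for in its Lie algebra. -/
instance instLEInftyMinSmoothnessReal : ENat.LEInfty (minSmoothness ℝ 3) :=
  ⟨by rw [minSmoothness_of_isRCLikeNormedField]; exact ENat.LEInfty.out⟩

namespace HighestWeightOrbit

noncomputable section

/-! ### The second fundamental form of a submanifold of the unit sphere -/

section SecondFundamentalForm

variable {V : Type*} [NormedAddCommGroup V] [InnerProductSpace ℝ V]

/-- The tangent space `T_p M` of a submanifold `M` of a Euclidean space: it is made of the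
velocities at `p` of the smooth curves lying in `M`. -/
def tangentSpaceAt (M : Set V) (p : V) : Submodule ℝ V :=
  Submodule.span ℝ {v | ∃ γ : ℝ → V, ContDiff ℝ ∞ γ ∧ (∀ s, γ s ∈ M) ∧ γ 0 = p ∧ deriv γ 0 = v}

/-- The normal space `ν_p M` at `p` of a submanifold `M` of the unit sphere, within the sphere:
the vectors orthogonal to `T_p M` and to `p`. -/
def normalSpaceAt (M : Set V) (p : V) : Submodule ℝ V :=
  (tangentSpaceAt M p ⊔ Submodule.span ℝ {p})ᗮ

/-- `W` is a smooth vector field, tangent to `M` along `M`, which extends the vector `w` at `p`. -/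
structure IsTangentExtension (M : Set V) (p w : V) (W : V → V) : Prop where
  contDiff : ContDiff ℝ ∞ W
  tangent : ∀ q ∈ M, W q ∈ tangentSpaceAt M q
  apply_eq : W p = w

/-- `HasSecondFundamentalForm M p v w n`: the second fundamental form at `p` of the submanifold `M`
of the unit sphere is well defined on the tangent vectors `v`, `w`, and `II_p (v, w) = n`.
By definition `II_p (v, w)` is the `ν_p M`-component of the derivative `D_v W`, where `W` is any
tangent vector field that extends `w`. (The covariant derivative of the sphere differs from the
Euclidean `D_v W` by a multiple of `p`, and `p` is orthogonal to `ν_p M`.) -/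
structure HasSecondFundamentalForm (M : Set V) (p v w n : V) : Prop where
  left_mem : v ∈ tangentSpaceAt M p
  right_mem : w ∈ tangentSpaceAt M p
  normal : n ∈ normalSpaceAt M p
  exists_extension : ∃ W, IsTangentExtension M p w W
  normal_component : ∀ W, IsTangentExtension M p w W →
    fderiv ℝ W p v - n ∈ tangentSpaceAt M p ⊔ Submodule.span ℝ {p}

end SecondFundamentalForm

/-! ### Roots of a complex Lie algebra with respect to a subspace `𝔥` (a Cartan subalgebra) -/

section Roots

variable {𝔤 : Type*} [LieRing 𝔤] [LieAlgebra ℂ 𝔤] (𝔥 : Submodule ℂ 𝔤)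

/-- `𝔤_α = {x | [h, x] = α(h) x for all h ∈ 𝔥}`. -/
def rootSpace (α : Module.Dual ℂ 𝔥) : Submodule ℂ 𝔤 where
  carrier := {x | ∀ h : 𝔥, ⁅(h : 𝔤), x⁆ = α h • x}
  add_mem' := fun {x y} hx hy h => by rw [lie_add, hx h, hy h, smul_add]
  zero_mem' := fun h => by rw [lie_zero, smul_zero]
  smul_mem' := fun c x hx h => by rw [lie_smul, hx h, smul_comm]

/-- The set `Δ` of roots. -/
def roots : Set (Module.Dual ℂ 𝔥) := {α | α ≠ 0 ∧ rootSpace 𝔥 α ≠ ⊥}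

/-- `P` is a system `Δ⁺` of positive roots. -/
structure IsPositiveSystem (P : Set (Module.Dual ℂ 𝔥)) : Prop where
  subset_roots : P ⊆ roots 𝔥
  pos_or_neg : ∀ α ∈ roots 𝔥, α ∈ P ∨ -α ∈ P
  not_pos_and_neg : ∀ α ∈ P, -α ∉ P
  add_mem : ∀ α ∈ P, ∀ β ∈ P, α + β ∈ roots 𝔥 → α + β ∈ P

/-- `a ∈ 𝔥` represents the functional `α` on `𝔥` through the Killing form. -/
def Represents (α : Module.Dual ℂ 𝔥) (a : 𝔥) : Prop :=
  ∀ h : 𝔥, killingForm ℂ 𝔤 (a : 𝔤) (h : 𝔤) = α h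

open Classical in
/-- The bilinear form `⟨α, β⟩` on the dual of `𝔥` which is transferred from the Killing form:
`⟨α, β⟩ = ⟨t_α, t_β⟩`, where `t_α`, `t_β` represent `α`, `β` through the Killing form. Such elements
exist for all roots, the value does not depend on their choice (they are unique up to the
centre), and it is a real number. -/
def dualKilling (α β : Module.Dual ℂ 𝔥) : ℝ :=
  if h : ∃ ab : 𝔥 × 𝔥, Represents 𝔥 α ab.1 ∧ Represents 𝔥 β ab.2 then
    (killingForm ℂ 𝔤 (h.choose.1 : 𝔤) (h.choose.2 : 𝔤)).re
  else 0

open Classical in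
/-- The constant `m_{α,β}`. -/
def mCoeff (α β : Module.Dual ℂ 𝔥) : ℝ :=
  if α = β ∨ dualKilling 𝔥 α β < 0 then √2 else 1

/-- A choice of root vectors `e_α ∈ 𝔤_α`, `f_α ∈ 𝔤_{-α}` for the positive roots `α`, adapted to the
real form `𝔨` of `𝔤`: `[e_α, f_α]` is the coroot `h_α ∈ 𝔥`, that is the element of
`𝔥 ∩ [𝔤_α, 𝔤_{-α}]` with `α(h_α) = 2`, and `e_α - f_α`, `i (e_α + f_α)` lie in `𝔨`. -/
structure IsRootVectorSystem (𝔨 : Set 𝔤) (P : Set (Module.Dual ℂ 𝔥))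
    (e f : Module.Dual ℂ 𝔥 → 𝔤) : Prop where
  e_mem : ∀ α ∈ P, e α ∈ rootSpace 𝔥 α
  f_mem : ∀ α ∈ P, f α ∈ rootSpace 𝔥 (-α)
  coroot : ∀ α ∈ P, ∃ h : 𝔥, ⁅e α, f α⁆ = (h : 𝔤) ∧ α h = 2
  x_mem : ∀ α ∈ P, e α - f α ∈ 𝔨
  y_mem : ∀ α ∈ P, Complex.I • (e α + f α) ∈ 𝔨

/-- `p` is a highest weight vector, of weight `μ`, of the representation `φ` of `𝔤`. -/
structure IsHighestWeightVector {V : Type*} [AddCommGroup V] [Module ℂ V]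
    (P : Set (Module.Dual ℂ 𝔥)) (φ : 𝔤 → V → V) (μ : Module.Dual ℂ 𝔥) (p : V) : Prop where
  ne_zero : p ≠ 0
  weight : ∀ h : 𝔥, φ (h : 𝔤) p = μ h • p
  highest : ∀ α ∈ P, ∀ x ∈ rootSpace 𝔥 α, φ x p = 0

end Roots

/-! ### Compact Lie groups, maximal tori, unitary representations -/

section LieGroup

variable (E : Type*) [NormedAddCommGroup E] [NormedSpace ℝ E]
  {K : Type*} [TopologicalSpace K] [ChartedSpace E K] [Group K]

/-- A torus of a compact Lie group: a closed connected abelian subgroup. -/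
structure IsTorus {K : Type*} [TopologicalSpace K] [Group K] (T : Subgroup K) : Prop where
  isClosed : IsClosed (T : Set K)
  isConnected : IsConnected (T : Set K)
  comm : ∀ a ∈ T, ∀ b ∈ T, a * b = b * a

/-- A maximal torus. -/
def IsMaximalTorus {K : Type*} [TopologicalSpace K] [Group K] (T : Subgroup K) : Prop :=
  IsTorus T ∧ ∀ T' : Subgroup K, IsTorus T' → T ≤ T' → T' = T

/-- The Lie algebra of a closed subgroup `T` of `K`, inside the Lie algebra of `K`: it is made of
the velocities at `1` of the smooth curves of `K` that lie in `T`. -/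
def lieAlgebraOf (T : Subgroup K) : Submodule ℝ (GroupLieAlgebra 𝓘(ℝ, E) K) :=
  Submodule.span ℝ {x | ∃ γ : ℝ → K, ContMDiff 𝓘(ℝ, ℝ) 𝓘(ℝ, E) ∞ γ ∧ (∀ s, γ s ∈ T) ∧ γ 0 = 1 ∧
    (mfderiv 𝓘(ℝ, ℝ) 𝓘(ℝ, E) γ 0 (1 : ℝ) : E) = x}

variable (K) in
/-- The complexification `𝔤 = ℂ ⊗ 𝔨` of the Lie algebra of `K`. -/
abbrev ComplexLieAlgebra : Type _ := ℂ ⊗[ℝ] GroupLieAlgebra 𝓘(ℝ, E) K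

variable (K) in
/-- The real form `𝔨` of `𝔤 = ℂ ⊗ 𝔨`. -/
def realForm : Set (ComplexLieAlgebra E K) :=
  Set.range fun x : GroupLieAlgebra 𝓘(ℝ, E) K => (1 : ℂ) ⊗ₜ[ℝ] x

/-- The Cartan subalgebra `𝔥 = 𝔱 ⊗ ℂ` of `𝔤`, where `𝔱` is the Lie algebra of `T`. -/
def cartan (T : Subgroup K) : Submodule ℂ (ComplexLieAlgebra E K) :=
  (lieAlgebraOf E T).baseChange ℂ

variable {V : Type*} [NormedAddCommGroup V] [InnerProductSpace ℂ V]

/-- `ρ` is a smooth unitary irreducible complex representation of `K`. -/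
structure IsIrreducibleUnitary (ρ : K →* (V →L[ℂ] V)) : Prop where
  smooth : ContMDiff 𝓘(ℝ, E) 𝓘(ℝ, V →L[ℂ] V) ∞ ρ
  unitary : ∀ g v w, inner ℂ (ρ g v) (ρ g w) = inner ℂ v w
  nontrivial : Nontrivial V
  irreducible : ∀ W : Submodule ℂ V, (∀ g, ∀ w ∈ W, ρ g w ∈ W) → W = ⊥ ∨ W = ⊤

/-- The derivative of `ρ` at `1`, which is the action of `𝔨` on `V`. -/
def differential (ρ : K →* (V →L[ℂ] V)) : GroupLieAlgebra 𝓘(ℝ, E) K →ₗ[ℝ] (V →L[ℂ] V) :=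
  (mfderiv 𝓘(ℝ, E) 𝓘(ℝ, V →L[ℂ] V) ρ 1 : E →L[ℝ] (V →L[ℂ] V)).toLinearMap

/-- The action of `𝔤 = ℂ ⊗ 𝔨` on `V`: the complex linear extension of the action of `𝔨`. -/
def complexAction (ρ : K →* (V →L[ℂ] V)) : ComplexLieAlgebra E K →ₗ[ℂ] (V →L[ℂ] V) :=
  (differential E ρ).liftBaseChange ℂ

/-- The orbit `K p`. -/
def orbit (ρ : K →* (V →L[ℂ] V)) (p : V) : Set V := Set.range fun g => ρ g p

end LieGroup

end

end HighestWeightOrbit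

/-! For `x, y ∈ 𝔨` the linear field `q ↦ y q` is tangent to the orbit, so `II_p(x p, y p)` is the
normal part of `y x p` (`exists_hasSecondFundamentalForm`). Since `e_α p = 0`, `f_α p` is the
velocity of `f_α - e_α ∈ 𝔨`, and `II_p(f_α p, f_β p)` is the normal part of `(f_β - e_β) f_α p`.

Negative root vectors map `p` into `T_p M` (`complexAction_mem_tangentSpaceAt`). Hence, modulo `T_p
M + ℝ p`, the term `e_β f_α p` vanishes and `f_β f_α p = f_α f_β p`: it suffices to bound one of
these two vectors.

As `f_β` acts by the adjoint of `e_β`, `‖f_β p‖² = μ(h_β) = n`, and if `e_β f_α p = 0` then `‖f_β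
f_α p‖² = (n - α(h_β)) ‖f_α p‖²`. For `n ≥ 1` the bound with constant `m ≥ 1` follows once `1 -
α(h_β) ≤ m²`. For `α = β` one has `‖f_α² p‖² = 2n(n - 1)` instead.

For `α ≠ β`, `α - β` and `β - α` are not both positive, so `e_β f_α p` or `e_α f_β p` is zero. If
`⟨α, β⟩ ≥ 0` the Cartan integers are nonnegative and `m = 1` works. If `⟨α, β⟩ < 0`, an admissible
order with Cartan integer `-1` is needed: the two integers are not both `≤ -2`
(`IsRootTriple.add_eq_zero_of_le`), and they agree when the order is forced
(`IsRootTriple.apply_coroot_eq_of_sub`). The facts on roots come from `sl₂` triples and traces, so a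
centre of `𝔤`, on which the Killing form degenerates, is harmless. -/

namespace HighestWeightOrbit

noncomputable section

/-! ### Eigenvalues -/

section Eigenvalues

/-- In a finite-dimensional representation, the element `h` of an `sl₂` triple has integral
eigenvalues. -/
lemma exists_int_of_lie_h_eq_smul {L M : Type*} [LieRing L] [LieAlgebra ℂ L] [AddCommGroup M]
    [Module ℂ M] [LieRingModule L M] [LieModule ℂ L M] [FiniteDimensional ℂ M] {h e f : L}
    (t : IsSl2Triple h e f) {m : M} (hm : m ≠ 0) {c : ℂ} (hc : ⁅h, m⁆ = c • m) :
    ∃ k : ℤ, c = k := by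
  -- Otherwise the vectors `eⁿ m` would be eigenvectors of `h` for the infinitely many values `c +
  -- 2n`.
  have key : ∃ k, ((LieModule.toEnd ℂ L M e) ^ k) m = 0 := by
    by_contra! contra
    have hinj : Function.Injective fun n : ℕ => c + 2 * (n : ℂ) := fun a b hab => by
      simpa using hab
    have aux (w : Set.range fun n : ℕ => c + 2 * (n : ℂ)) :
        (LieModule.toEnd ℂ L M h).HasEigenvector w
          (((LieModule.toEnd ℂ L M e) ^ w.property.choose) m) := by
      refine ⟨?_, contra _⟩
      rw [Module.End.mem_eigenspace_iff, LieModule.toEnd_apply_apply,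
        t.lie_h_pow_toEnd_e hc]
      exact congrArg (· • _) w.property.choose_spec
    have := ((LieModule.toEnd ℂ L M h).eigenvectors_linearIndependent _ _ aux).finite
    exact Set.infinite_range_of_injective hinj (Set.toFinite _)
  obtain ⟨n, hn, hn'⟩ := Nat.exists_not_and_succ_of_not_zero_of_exists (by simpa using hm) key
  have hprim : t.HasPrimitiveVectorWith (((LieModule.toEnd ℂ L M e) ^ n) m) (c + 2 * n) :=
    { ne_zero := hn
      lie_h := t.lie_h_pow_toEnd_e hc n
      lie_e := by rwa [IsSl2Triple.lie_e_pow_toEnd_e] }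
  obtain ⟨N, hN⟩ := hprim.exists_nat
  exact ⟨N - 2 * n, by push_cast; linear_combination hN⟩

open scoped ComplexOrder in
/-- The trace of the square of an endomorphism with real eigenvalues is nonnegative, and it
vanishes only if the endomorphism is nilpotent. -/
lemma trace_mul_self_nonneg {W : Type*} [AddCommGroup W] [Module ℂ W] [FiniteDimensional ℂ W]
    (f : Module.End ℂ W) (hf : ∀ c, f.HasEigenvalue c → c.im = 0) :
    0 ≤ LinearMap.trace ℂ W (f * f) ∧ (LinearMap.trace ℂ W (f * f) = 0 → IsNilpotent f) := by
  have hroots : ∀ c ∈ (f * f).charpoly.roots, 0 ≤ c := by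
    intro c hc
    have hc' : (f * f).HasEigenvalue c :=
      (Module.End.hasEigenvalue_iff_isRoot_charpoly _ _).2 (Polynomial.isRoot_of_mem_roots hc)
    obtain ⟨v, hv⟩ := hc'.exists_hasEigenvector
    obtain ⟨w, hw⟩ := IsAlgClosed.exists_pow_nat_eq c (n := 2) (by norm_num)
    -- Since `(f - w)(f + w) v = 0`, either `-w` or `w` is an eigenvalue of `f`.
    have hreal : w.im = 0 := by
      by_cases hz : f v + w • v = 0
      · have : f.HasEigenvalue (-w) := Module.End.hasEigenvalue_of_hasEigenvector
          (x := v) ⟨Module.End.mem_eigenspace_iff.2 (by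
            rw [neg_smul]; exact eq_neg_of_add_eq_zero_left hz), hv.2⟩
        simpa using hf _ this
      · refine hf w (Module.End.hasEigenvalue_of_hasEigenvector (x := f v + w • v)
          ⟨Module.End.mem_eigenspace_iff.2 ?_, hz⟩)
        have h1 : f (f v) = c • v := hv.apply_eq_smul
        rw [map_add, h1, map_smul, smul_add, smul_smul, ← hw, pow_two, add_comm]
    have : c = ((w.re ^ 2 : ℝ) : ℂ) := by
      rw [← hw]; apply Complex.ext <;> simp [pow_two, hreal]
    rw [this]
    exact_mod_cast sq_nonneg w.re
  have htr : LinearMap.trace ℂ W (f * f) = (f * f).charpoly.roots.sum :=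
    Module.End.trace_eq_sum_roots_charpoly_of_splits (IsAlgClosed.splits _)
  refine ⟨htr ▸ Multiset.sum_nonneg hroots, fun h0 => ?_⟩
  have hz : ∀ c ∈ (f * f).charpoly.roots, c = 0 :=
    Multiset.all_zero_of_le_zero_le_of_sum_eq_zero hroots (htr ▸ h0)
  have hpow : (f * f).charpoly = Polynomial.X ^ Module.finrank ℂ W := by
    have hs := (IsAlgClosed.splits (f * f).charpoly).eq_prod_roots
    have hcard : (f * f).charpoly.roots.card = Module.finrank ℂ W := by
      rw [(IsAlgClosed.splits (f * f).charpoly).natDegree_eq_card_roots.symm,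
        LinearMap.charpoly_natDegree]
    rw [hs, (LinearMap.charpoly_monic _).leadingCoeff, Multiset.eq_replicate.2 ⟨hcard, hz⟩]
    simp
  obtain ⟨n, hn⟩ := (LinearMap.isNilpotent_iff_charpoly _).2 hpow
  exact ⟨2 * n, by rw [pow_mul, pow_two, hn]⟩

/-- Two commuting endomorphisms, the first of which preserves the eigenspaces of the second one,
have a common eigenvector in each such eigenspace. -/
lemma exists_common_eigenvector {W : Type*} [AddCommGroup W] [Module ℂ W] [FiniteDimensional ℂ W]
    {f g : Module.End ℂ W} (hfg : Commute f g) {c : ℂ} (hc : g.HasEigenvalue c) :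
    ∃ (a : ℂ) (v : W), v ≠ 0 ∧ f v = a • v ∧ g v = c • v := by
  have hmaps : ∀ x ∈ g.eigenspace c, f x ∈ g.eigenspace c :=
    Module.End.mapsTo_genEigenspace_of_comm hfg.symm c 1
  have : Nontrivial (g.eigenspace c) := (Submodule.nontrivial_iff_ne_bot).2 hc
  obtain ⟨a, ha⟩ := Module.End.exists_eigenvalue (f.restrict hmaps)
  obtain ⟨v, hv⟩ := ha.exists_hasEigenvector
  refine ⟨a, v, by simpa using hv.2, ?_, Module.End.mem_eigenspace_iff.1 v.2⟩
  simpa using congrArg Subtype.val hv.apply_eq_smul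

end Eigenvalues

/-! ### Coroots and the Killing form -/

section RootTriples

variable {𝔤 : Type*} [LieRing 𝔤] [LieAlgebra ℂ 𝔤] {𝔥 : Submodule ℂ 𝔤}

/-- Root vectors of `α` and `-α` whose bracket is the coroot `h` of `α`. -/
structure IsRootTriple (𝔥 : Submodule ℂ 𝔤) (α : Module.Dual ℂ 𝔥) (h : 𝔥) (e f : 𝔤) : Prop where
  e_mem : e ∈ rootSpace 𝔥 α
  f_mem : f ∈ rootSpace 𝔥 (-α)
  lie_e_f : ⁅e, f⁆ = (h : 𝔤)
  apply_coroot : α h = 2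

lemma lie_mem_rootSpace {α β : Module.Dual ℂ 𝔥} {x y : 𝔤} (hx : x ∈ rootSpace 𝔥 α)
    (hy : y ∈ rootSpace 𝔥 β) : ⁅x, y⁆ ∈ rootSpace 𝔥 (α + β) := fun h => by
  rw [leibniz_lie, hx h, hy h, smul_lie, lie_smul, ← add_smul, LinearMap.add_apply]

namespace IsRootTriple

variable {α β γ : Module.Dual ℂ 𝔥} {h h' : 𝔥} {e f e' f' : 𝔤}

lemma lie_h (ht : IsRootTriple 𝔥 α h e f) (k : 𝔥) : ⁅(k : 𝔤), (h : 𝔤)⁆ = 0 := by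
  have := lie_mem_rootSpace ht.e_mem ht.f_mem k
  rwa [ht.lie_e_f, add_neg_cancel, LinearMap.zero_apply, zero_smul] at this

lemma isSl2Triple (ht : IsRootTriple 𝔥 α h e f) : IsSl2Triple (h : 𝔤) e f where
  h_ne_zero := fun h0 => by
    have h1 := ht.apply_coroot
    rw [show h = 0 from Subtype.ext h0, map_zero] at h1
    norm_num at h1
  lie_e_f := ht.lie_e_f
  lie_h_e_nsmul := by rw [ht.e_mem h, ht.apply_coroot, ofNat_smul_eq_nsmul]
  lie_h_f_nsmul := by
    rw [ht.f_mem h, LinearMap.neg_apply, ht.apply_coroot, neg_smul, ofNat_smul_eq_nsmul]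

/-- Invariance of the Killing form: `κ(k, [e, f]) = κ([k, e], f)`. -/
lemma killingForm_coroot (ht : IsRootTriple 𝔥 α h e f) (k : 𝔥) :
    killingForm ℂ 𝔤 (h : 𝔤) (k : 𝔤) = α k * killingForm ℂ 𝔤 e f := by
  have := LieModule.traceForm_apply_lie_apply ℂ 𝔤 𝔤 (k : 𝔤) e f
  rw [ht.lie_e_f, ht.e_mem k, map_smul, LinearMap.smul_apply, smul_eq_mul] at this
  rw [killingForm, LieModule.traceForm_comm]
  exact this.symm

variable [FiniteDimensional ℂ 𝔤]

lemma exists_int (ht : IsRootTriple 𝔥 α h e f) {x : 𝔤} (hx0 : x ≠ 0) (hx : x ∈ rootSpace 𝔥 γ) :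
    ∃ k : ℤ, γ h = k :=
  exists_int_of_lie_h_eq_smul ht.isSl2Triple hx0 (hx h)

lemma im_eq_zero_of_hasEigenvalue (ht : IsRootTriple 𝔥 α h e f) {c : ℂ}
    (hc : (LieAlgebra.ad ℂ 𝔤 (h : 𝔤)).HasEigenvalue c) : c.im = 0 := by
  obtain ⟨v, hv⟩ := hc.exists_hasEigenvector
  obtain ⟨k, rfl⟩ := exists_int_of_lie_h_eq_smul ht.isSl2Triple hv.2 hv.apply_eq_smul
  simp

/-- `2 κ(e, f) = κ(h, h)` is the trace of `(ad h)²`, and `ad h` has integral eigenvalues; if it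
vanished, `ad h` would be nilpotent, against `[h, e] = 2 e`. This number is `2 / ⟨α, α⟩`. -/
lemma exists_pos_killingForm (ht : IsRootTriple 𝔥 α h e f) :
    ∃ s : ℝ, 0 < s ∧ killingForm ℂ 𝔤 e f = s := by
  obtain ⟨h0, hnil⟩ := trace_mul_self_nonneg (LieAlgebra.ad ℂ 𝔤 (h : 𝔤))
    fun c hc => ht.im_eq_zero_of_hasEigenvalue hc
  have hk : LinearMap.trace ℂ 𝔤 (LieAlgebra.ad ℂ 𝔤 (h : 𝔤) * LieAlgebra.ad ℂ 𝔤 (h : 𝔤)) =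
      2 * killingForm ℂ 𝔤 e f := by
    rw [← ht.apply_coroot, ← ht.killingForm_coroot h]; rfl
  rw [hk] at h0 hnil
  obtain ⟨hre, him⟩ := Complex.le_def.1 h0
  simp only [Complex.mul_re, Complex.mul_im, Complex.re_ofNat, Complex.im_ofNat, zero_mul,
    sub_zero, add_zero, Complex.zero_re, Complex.zero_im] at hre him
  have him' : (killingForm ℂ 𝔤 e f).im = 0 := by linarith
  refine ⟨(killingForm ℂ 𝔤 e f).re, lt_of_le_of_ne (by linarith) fun h1 => ?_,
    Complex.ext rfl (by simpa using him')⟩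
  have hz : killingForm ℂ 𝔤 e f = 0 := Complex.ext h1.symm him'
  obtain ⟨n, hn⟩ := hnil (by rw [hz, mul_zero])
  have hv : (LieAlgebra.ad ℂ 𝔤 (h : 𝔤)).HasEigenvector 2 e :=
    ⟨Module.End.mem_eigenspace_iff.2 (by
      rw [LieAlgebra.ad_apply, ht.e_mem h, ht.apply_coroot]), ht.isSl2Triple.e_ne_zero⟩
  have := hv.pow_apply n
  rw [hn, LinearMap.zero_apply] at this
  exact (smul_ne_zero (pow_ne_zero n two_ne_zero) ht.isSl2Triple.e_ne_zero) this.symm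

lemma represents (ht : IsRootTriple 𝔥 α h e f) :
    Represents 𝔥 α ((killingForm ℂ 𝔤 e f)⁻¹ • h) := fun k => by
  obtain ⟨s, hs, hs'⟩ := ht.exists_pos_killingForm
  have : killingForm ℂ 𝔤 e f ≠ 0 := by rw [hs']; exact_mod_cast hs.ne'
  rw [Submodule.coe_smul, map_smul, LinearMap.smul_apply, ht.killingForm_coroot, smul_eq_mul]
  field_simp

/-- The representatives chosen in `dualKilling` are traded for multiples of the coroots, one
argument at a time. -/
lemma dualKilling_eq (ht : IsRootTriple 𝔥 α h e f) (ht' : IsRootTriple 𝔥 β h' e' f') :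
    dualKilling 𝔥 α β = ((killingForm ℂ 𝔤 e f)⁻¹ * β h).re := by
  have hex : ∃ ab : 𝔥 × 𝔥, Represents 𝔥 α ab.1 ∧ Represents 𝔥 β ab.2 :=
    ⟨(_, _), ht.represents, ht'.represents⟩
  rw [dualKilling, dif_pos hex]
  congr 1
  obtain ⟨h1, h2⟩ := hex.choose_spec
  rw [h1, ← ht.represents, killingForm, LieModule.traceForm_comm, ← killingForm, h2, map_smul,
    smul_eq_mul]

/-- Two roots with Cartan integers at most `-2` are opposite to each other. -/
lemma add_eq_zero_of_le (ht : IsRootTriple 𝔥 α h e f) (ht' : IsRootTriple 𝔥 β h' e' f')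
    {a b : ℝ} (ha : α h' = a) (hb : β h = b) (ha2 : a ≤ -2) (hb2 : b ≤ -2) : α + β = 0 := by
  obtain ⟨s, hs, hs'⟩ := ht.exists_pos_killingForm
  obtain ⟨s', hs0', hs''⟩ := ht'.exists_pos_killingForm
  -- This is `t_α + t_β`, which represents `α + β`.
  set x : 𝔥 := (killingForm ℂ 𝔤 e f)⁻¹ • h + (killingForm ℂ 𝔤 e' f')⁻¹ • h' with hx
  have hrep : ∀ k : 𝔥, killingForm ℂ 𝔤 (x : 𝔤) (k : 𝔤) = (α + β) k := fun k => by
    rw [hx, Submodule.coe_add, map_add, LinearMap.add_apply, ht.represents, ht'.represents,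
      LinearMap.add_apply]
  have hcomm : ∀ k : 𝔥, ⁅(k : 𝔤), (x : 𝔤)⁆ = 0 := fun k => by
    rw [hx, Submodule.coe_add, lie_add, Submodule.coe_smul, Submodule.coe_smul, lie_smul, lie_smul,
      ht.lie_h, ht'.lie_h, smul_zero, smul_zero, add_zero]
  have hcomm' : ∀ k : 𝔥, Commute (LieAlgebra.ad ℂ 𝔤 (k : 𝔤)) (LieAlgebra.ad ℂ 𝔤 (x : 𝔤)) :=
    fun k => LinearMap.ext fun v => by
      rw [Module.End.mul_apply, Module.End.mul_apply, LieAlgebra.ad_apply, LieAlgebra.ad_apply,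
        LieAlgebra.ad_apply, LieAlgebra.ad_apply, leibniz_lie, hcomm, zero_lie, zero_add]
  -- A common eigenvector of `ad h` and `ad x` is also one of `ad h'`, so `c` is a real combination
  -- of two integers.
  have hreal : ∀ c, (LieAlgebra.ad ℂ 𝔤 (x : 𝔤)).HasEigenvalue c → c.im = 0 := fun c hc => by
    obtain ⟨d, v, hv0, hd, hv⟩ := exists_common_eigenvector (hcomm' h) hc
    obtain ⟨k, rfl⟩ := exists_int_of_lie_h_eq_smul ht.isSl2Triple hv0 hd
    have hne : (s' : ℂ) ≠ 0 := by exact_mod_cast hs0'.ne'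
    have hv' : ⁅(h' : 𝔤), v⁆ = (s' * (c - (s : ℂ)⁻¹ * k)) • v := by
      have h1 : (s : ℂ)⁻¹ • ⁅(h : 𝔤), v⁆ + (s' : ℂ)⁻¹ • ⁅(h' : 𝔤), v⁆ = c • v := by
        rw [← hv, LieAlgebra.ad_apply, hx, Submodule.coe_add, add_lie, Submodule.coe_smul,
          Submodule.coe_smul, smul_lie, smul_lie, hs', hs'']
      have h2 : ⁅(h : 𝔤), v⁆ = (k : ℂ) • v := hd
      rw [mul_smul, sub_smul, ← h1, mul_smul, h2, add_sub_cancel_left, smul_smul,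
        mul_inv_cancel₀ hne, one_smul]
    obtain ⟨l, hl⟩ := exists_int_of_lie_h_eq_smul ht'.isSl2Triple hv0 hv'
    have hc : c = ((s'⁻¹ * l + s⁻¹ * k : ℝ) : ℂ) := by
      push_cast
      rw [← hl]
      field_simp
      ring
    rw [hc, Complex.ofReal_im]
  obtain ⟨h0, hnil⟩ := trace_mul_self_nonneg _ hreal
  have htr : LinearMap.trace ℂ 𝔤 (LieAlgebra.ad ℂ 𝔤 (x : 𝔤) * LieAlgebra.ad ℂ 𝔤 (x : 𝔤)) =
      ((s⁻¹ * (2 + b) + s'⁻¹ * (2 + a) : ℝ) : ℂ) := by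
    have h1 : LinearMap.trace ℂ 𝔤 (LieAlgebra.ad ℂ 𝔤 (x : 𝔤) * LieAlgebra.ad ℂ 𝔤 (x : 𝔤)) =
      killingForm ℂ 𝔤 (x : 𝔤) (x : 𝔤) := rfl
    rw [h1, hrep, hx, map_add, map_smul, map_smul, LinearMap.add_apply, LinearMap.add_apply,
      ht.apply_coroot, ht'.apply_coroot, ha, hb, hs', hs'']
    push_cast
    simp only [smul_eq_mul]
    ring
  rw [htr] at h0 hnil
  have hle : s⁻¹ * (2 + b) + s'⁻¹ * (2 + a) ≤ 0 :=
    add_nonpos (mul_nonpos_of_nonneg_of_nonpos (by positivity) (by linarith))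
      (mul_nonpos_of_nonneg_of_nonpos (by positivity) (by linarith))
  have hge : 0 ≤ s⁻¹ * (2 + b) + s'⁻¹ * (2 + a) := by exact_mod_cast h0
  have hnil' := hnil (by rw [le_antisymm hle hge, Complex.ofReal_zero])
  -- `ad x` is nilpotent and commutes with `ad k`, so the trace of their product, `(α + β)(k)`, is
  -- zero.
  ext k
  rw [← hrep, LinearMap.zero_apply]
  exact (LinearMap.isNilpotent_trace_of_isNilpotent
    ((hcomm' k).symm.isNilpotent_mul_right hnil')).eq_zero

end IsRootTriple

end RootTriples

/-! ### Cartan integers of positive roots -/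

section CartanIntegers

variable {𝔤 : Type*} [LieRing 𝔤] [LieAlgebra ℂ 𝔤] {𝔥 : Submodule ℂ 𝔤}

namespace IsRootTriple

variable {α β : Module.Dual ℂ 𝔥} {h h' h'' : 𝔥} {e f e' f' e'' f'' : 𝔤}

/-- `κ(h, h')` computed in two ways; this is the symmetry of `⟨α, β⟩`. -/
lemma apply_mul_killingForm (ht : IsRootTriple 𝔥 α h e f) (ht' : IsRootTriple 𝔥 β h' e' f') :
    α h' * killingForm ℂ 𝔤 e f = β h * killingForm ℂ 𝔤 e' f' := by
  rw [← ht.killingForm_coroot, ← ht'.killingForm_coroot]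
  exact LieModule.traceForm_comm _ _ _ _ _

variable [FiniteDimensional ℂ 𝔤]

lemma exists_cartan_int (ht : IsRootTriple 𝔥 α h e f) (ht' : IsRootTriple 𝔥 β h' e' f') :
    ∃ k : ℤ, α h' = k :=
  ht'.exists_int ht.isSl2Triple.e_ne_zero ht.e_mem

/-- The sign of `⟨α, β⟩` is the sign of the Cartan integers. -/
lemma exists_mul_dualKilling (ht : IsRootTriple 𝔥 α h e f) (ht' : IsRootTriple 𝔥 β h' e' f') :
    ∃ s > (0 : ℝ), α h' = (s * dualKilling 𝔥 α β : ℝ) := by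
  obtain ⟨s, hs, hs'⟩ := ht.exists_pos_killingForm
  obtain ⟨s', hs0', hs''⟩ := ht'.exists_pos_killingForm
  obtain ⟨k, hk⟩ := ht'.exists_cartan_int ht
  have hsym := ht.apply_mul_killingForm ht'
  have hne : (s : ℂ) ≠ 0 := by exact_mod_cast hs.ne'
  rw [hk, hs', hs''] at hsym
  have hD : dualKilling 𝔥 α β = s⁻¹ * k := by
    rw [ht.dualKilling_eq ht', hk, hs']
    exact_mod_cast Complex.ofReal_re (s⁻¹ * k)
  -- The factor is `s' = 2 / ⟨β, β⟩`.
  refine ⟨s', hs0', ?_⟩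
  rw [hD]
  push_cast
  field_simp
  linear_combination hsym

/-- If the difference of two roots at an obtuse angle is a root, then they have equal lengths. -/
lemma apply_coroot_eq_of_sub (ht : IsRootTriple 𝔥 α h e f) (ht' : IsRootTriple 𝔥 β h' e' f')
    (ht'' : IsRootTriple 𝔥 (α - β) h'' e'' f'') {a b : ℤ} (ha : α h' = a) (hb : β h = b)
    (ha0 : a < 0) (hb0 : b < 0) : a = b := by
  obtain ⟨s, hs, hs'⟩ := ht.exists_pos_killingForm
  obtain ⟨s', hs0', hs1'⟩ := ht'.exists_pos_killingForm
  obtain ⟨r, hr, hr'⟩ := ht''.exists_pos_killingForm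
  obtain ⟨c, hc⟩ := ht.exists_cartan_int ht''
  obtain ⟨d, hd⟩ := ht'.exists_cartan_int ht''
  have h1 := ht.apply_mul_killingForm ht'
  have h2 := ht.apply_mul_killingForm ht''
  have h3 := ht'.apply_mul_killingForm ht''
  have h4 := ht''.apply_coroot
  rw [ha, hb, hs', hs1'] at h1
  rw [hc, LinearMap.sub_apply, ht.apply_coroot, hb, hs', hr'] at h2
  rw [hd, LinearMap.sub_apply, ht'.apply_coroot, ha, hs1', hr'] at h3
  rw [LinearMap.sub_apply, hc, hd] at h4
  have h1' : (a : ℝ) * s = b * s' := by exact_mod_cast h1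
  have h2' : (c : ℝ) * s = (2 - b) * r := by exact_mod_cast h2
  have h3' : (d : ℝ) * s' = (a - 2) * r := by exact_mod_cast h3
  have h4' : c - d = 2 := by exact_mod_cast h4
  have ha1 : (a : ℝ) < 0 := by exact_mod_cast ha0
  have hb1 : (b : ℝ) < 0 := by exact_mod_cast hb0
  -- The values `c`, `d` of `α`, `β` on the coroot of `α - β` have opposite signs and difference
  -- `2`, so they are `1` and `-1`.
  have hc0 : 0 < c := by
    have : 0 < (c : ℝ) := pos_of_mul_pos_left (h2' ▸ mul_pos (by linarith) hr) hs.le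
    exact_mod_cast this
  have hd0 : d < 0 := by
    have : (d : ℝ) < 0 := by
      by_contra! hcon
      have := mul_nonneg hcon hs0'.le
      have := mul_pos_of_neg_of_neg (a := (a : ℝ) - 2) (b := -r) (by linarith) (by linarith)
      linarith
    exact_mod_cast this
  obtain rfl : c = 1 := by omega
  obtain rfl : d = -1 := by omega
  push_cast at h2' h3'
  -- Now `a s = b s'` reads `a (2 - b) = b (2 - a)`.
  have h5 : s = (2 - b) * r := by linarith
  have h6 : s' = (2 - a) * r := by linarith
  rw [h5, h6] at h1'
  have h7 : (a : ℝ) = b := by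
    have : r * ((a : ℝ) - b) = 0 := by linear_combination h1' / 2
    rcases mul_eq_zero.1 this with h | h <;> linarith
  exact_mod_cast h7

end IsRootTriple

end CartanIntegers

/-! ### Highest weight vectors in unitary representations -/

section HighestWeight

variable {𝔤 : Type*} [LieRing 𝔤] [LieAlgebra ℂ 𝔤] {𝔥 : Submodule ℂ 𝔤}
  {V : Type*} [NormedAddCommGroup V] [InnerProductSpace ℂ V]
  [LieRingModule 𝔤 V] [LieModule ℂ 𝔤 V]

/-- If `e - f` and `i (e + f)` act by skew-Hermitian operators, then `f` acts by the adjoint of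
`e`. -/
lemma inner_lie_eq_inner_lie {e f : 𝔤}
    (hx : ∀ v w : V, inner ℂ ⁅e - f, v⁆ w = -inner ℂ v ⁅e - f, w⁆)
    (hy : ∀ v w : V, inner ℂ ⁅Complex.I • (e + f), v⁆ w = -inner ℂ v ⁅Complex.I • (e + f), w⁆)
    (v w : V) : inner ℂ ⁅f, v⁆ w = inner ℂ v ⁅e, w⁆ := by
  have h1 := hx v w
  have h2 := hy v w
  simp only [sub_lie, smul_lie, add_lie, inner_sub_left, inner_sub_right, inner_smul_left,
    inner_smul_right, inner_add_left, inner_add_right, Complex.conj_I] at h1 h2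
  -- After this multiplication, `h2` says that `e + f` is Hermitian; `e - f` is skew-Hermitian by
  -- `h1`.
  have h3 := congrArg (Complex.I * ·) h2
  simp only [neg_mul, mul_neg, ← mul_assoc, Complex.I_mul_I] at h3
  linear_combination (h3 - h1) / 2

section

variable {α β μ : Module.Dual ℂ 𝔥} {h h' : 𝔥} {e f e' f' : 𝔤} {p : V}

lemma IsRootTriple.lie_lie_f (ht : IsRootTriple 𝔥 α h e f) (hμ : ∀ k : 𝔥, ⁅(k : 𝔤), p⁆ = μ k • p)
    (k : 𝔥) : ⁅(k : 𝔤), ⁅f, p⁆⁆ = (μ k - α k) • ⁅f, p⁆ := by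
  rw [leibniz_lie, ht.f_mem k, hμ, smul_lie, lie_smul, ← add_smul, LinearMap.neg_apply]
  congr 1
  ring

-- `‖f w‖² = ⟨w, e f w⟩`, with `e f = h + f e`.
omit [LieModule ℂ 𝔤 V] in
lemma norm_lie_f_sq (hef : ⁅e, f⁆ = (h : 𝔤))
    (hadj : ∀ v w : V, inner ℂ ⁅f, v⁆ w = inner ℂ v ⁅e, w⁆) {w : V} {a b : ℝ}
    (hh : ⁅(h : 𝔤), w⁆ = (a : ℂ) • w) (hfe : ⁅f, ⁅e, w⁆⁆ = (b : ℂ) • w) :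
    ‖⁅f, w⁆‖ ^ 2 = (a + b) * ‖w‖ ^ 2 := by
  have h1 : inner ℂ ⁅f, w⁆ ⁅f, w⁆ = ((a : ℂ) + b) * ((‖w‖ : ℂ) ^ 2) := by
    rw [hadj, leibniz_lie, hef, hh, hfe, ← add_smul, inner_smul_right,
      inner_self_eq_norm_sq_to_K]
    rfl
  rw [inner_self_eq_norm_sq_to_K] at h1
  exact Complex.ofReal_injective (by push_cast; exact h1)

lemma IsRootTriple.exists_nat_norm_sq [FiniteDimensional ℂ V] (ht : IsRootTriple 𝔥 α h e f)
    (hμ : ∀ k : 𝔥, ⁅(k : 𝔤), p⁆ = μ k • p) (hp : ‖p‖ = 1) (hep : ⁅e, p⁆ = 0)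
    (hadj : ∀ v w : V, inner ℂ ⁅f, v⁆ w = inner ℂ v ⁅e, w⁆) :
    ∃ n : ℕ, μ h = n ∧ ‖⁅f, p⁆‖ ^ 2 = n := by
  have hp0 : p ≠ 0 := fun h0 => by simp [h0] at hp
  have hprim : ht.isSl2Triple.HasPrimitiveVectorWith p (μ h) := ⟨hp0, hμ h, hep⟩
  obtain ⟨n, hn⟩ := hprim.exists_nat
  refine ⟨n, hn, ?_⟩
  have h1 : inner ℂ ⁅f, p⁆ ⁅f, p⁆ = (n : ℂ) := by
    rw [hadj, leibniz_lie, hep, lie_zero, add_zero, ht.lie_e_f, hμ, inner_smul_right,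
      inner_self_eq_norm_sq_to_K, hp, hn]
    simp
  rw [inner_self_eq_norm_sq_to_K] at h1
  exact Complex.ofReal_injective (by push_cast; exact h1)

/-- The bound on `f² p` for a single root. -/
lemma IsRootTriple.norm_lie_f_lie_f_le [FiniteDimensional ℂ V] (ht : IsRootTriple 𝔥 α h e f)
    (hμ : ∀ k : 𝔥, ⁅(k : 𝔤), p⁆ = μ k • p) (hp : ‖p‖ = 1) (hep : ⁅e, p⁆ = 0)
    (hadj : ∀ v w : V, inner ℂ ⁅f, v⁆ w = inner ℂ v ⁅e, w⁆) :
    ‖⁅f, ⁅f, p⁆⁆‖ ≤ √2 * ‖⁅f, p⁆‖ * ‖⁅f, p⁆‖ := by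
  obtain ⟨n, hn, hn'⟩ := ht.exists_nat_norm_sq hμ hp hep hadj
  -- `h` acts on `f p` by `n - 2`, and `f e f p = f h p = n f p`.
  have h1 := norm_lie_f_sq (w := ⁅f, p⁆) (a := n - 2) (b := n) ht.lie_e_f hadj
    (by rw [ht.lie_lie_f hμ, hn, ht.apply_coroot]; push_cast; rfl)
    (by rw [leibniz_lie e, hep, lie_zero, add_zero, ht.lie_e_f, hμ, lie_smul, hn,
        Complex.ofReal_natCast])
  refine abs_le_of_sq_le_sq' ?_ (by positivity) |>.2
  rw [h1, mul_pow, mul_pow, Real.sq_sqrt (by norm_num), hn']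
  nlinarith [Nat.cast_nonneg (α := ℝ) n]

/-- The bound on `f_β f_α p` for two roots such that `e_β f_α p = 0`, by the Cartan integer
`α(h_β)`. -/
lemma IsRootTriple.norm_lie_f_lie_f_le_of_lie_eq_zero [FiniteDimensional ℂ V]
    (ht : IsRootTriple 𝔥 α h e f)
    (ht' : IsRootTriple 𝔥 β h' e' f') (hμ : ∀ k : 𝔥, ⁅(k : 𝔤), p⁆ = μ k • p) (hp : ‖p‖ = 1)
    (hep' : ⁅e', p⁆ = 0) (hadj' : ∀ v w : V, inner ℂ ⁅f', v⁆ w = inner ℂ v ⁅e', w⁆)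
    (hz : ⁅e', ⁅f, p⁆⁆ = 0) (hf0 : ⁅f', p⁆ ≠ 0) {a : ℤ} (ha : α h' = a) {m : ℝ} (hm : 1 ≤ m)
    (hma : 1 - a ≤ m ^ 2) :
    ‖⁅f', ⁅f, p⁆⁆‖ ≤ m * ‖⁅f, p⁆‖ * ‖⁅f', p⁆‖ := by
  obtain ⟨n, hn, hn'⟩ := ht'.exists_nat_norm_sq hμ hp hep' hadj'
  have hn1 : (1 : ℝ) ≤ n := by
    have : 0 < (n : ℝ) := hn' ▸ pow_pos (norm_pos_iff.2 hf0) 2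
    exact_mod_cast this
  have h1 := norm_lie_f_sq (w := ⁅f, p⁆) (a := n - a) (b := 0) ht'.lie_e_f hadj'
    (by rw [ht.lie_lie_f hμ, hn, ha]; push_cast; rfl)
    (by rw [hz, lie_zero, Complex.ofReal_zero, zero_smul])
  refine abs_le_of_sq_le_sq' ?_ (by positivity) |>.2
  rw [h1, mul_pow, mul_pow, hn', add_zero]
  -- `n - a = (n - 1) + (1 - a)`, and both `n - 1 ≥ 0` and `m ≥ 1` are used.
  have h2 : (n : ℝ) - a ≤ m ^ 2 * n := by nlinarith [one_le_pow₀ hm (n := 2)]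
  nlinarith [sq_nonneg ‖⁅f, p⁆‖]

end

variable [FiniteDimensional ℂ 𝔤] [FiniteDimensional ℂ V]

/-- The highest weight estimate: modulo the subspace `S`, the vector `f_β f_α p - e_β f_α p` is
bounded by `m_{α,β} ‖f_α p‖ ‖f_β p‖`, if `S` contains the vectors `z p` for `z` in a negative
root space. -/
theorem exists_sub_mem_norm_le {𝔨 : Set 𝔤} {P : Set (Module.Dual ℂ 𝔥)}
    (hP : IsPositiveSystem 𝔥 P) {e f : Module.Dual ℂ 𝔥 → 𝔤} (hef : IsRootVectorSystem 𝔥 𝔨 P e f)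
    (hskew : ∀ x ∈ 𝔨, ∀ v w : V, inner ℂ ⁅x, v⁆ w = -inner ℂ v ⁅x, w⁆)
    {μ : Module.Dual ℂ 𝔥} {p : V} (hμ : ∀ k : 𝔥, ⁅(k : 𝔤), p⁆ = μ k • p)
    (hhigh : ∀ α ∈ P, ∀ x ∈ rootSpace 𝔥 α, ⁅x, p⁆ = 0) (hp : ‖p‖ = 1)
    (S : Submodule ℝ V) (hpS : p ∈ S) (hS : ∀ γ ∈ P, ∀ z ∈ rootSpace 𝔥 (-γ), ⁅z, p⁆ ∈ S)
    {α β : Module.Dual ℂ 𝔥} (hα : α ∈ P) (hβ : β ∈ P) :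
    ∃ u : V, ⁅f β, ⁅f α, p⁆⁆ - ⁅e β, ⁅f α, p⁆⁆ - u ∈ S ∧
      ‖u‖ ≤ mCoeff 𝔥 α β * ‖⁅f α, p⁆‖ * ‖⁅f β, p⁆‖ := by
  have htriple : ∀ γ ∈ P, ∃ h : 𝔥, IsRootTriple 𝔥 γ h (e γ) (f γ) := fun γ hγ => by
    obtain ⟨h, h1, h2⟩ := hef.coroot γ hγ
    exact ⟨h, hef.e_mem γ hγ, hef.f_mem γ hγ, h1, h2⟩
  have hadj : ∀ γ ∈ P, ∀ v w : V, inner ℂ ⁅f γ, v⁆ w = inner ℂ v ⁅e γ, w⁆ := fun γ hγ =>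
    inner_lie_eq_inner_lie (hskew _ (hef.x_mem γ hγ)) (hskew _ (hef.y_mem γ hγ))
  have hkill : ∀ γ ∈ P, ⁅e γ, p⁆ = 0 := fun γ hγ => hhigh γ hγ _ (hef.e_mem γ hγ)
  obtain ⟨h, ht⟩ := htriple α hα
  obtain ⟨h', ht'⟩ := htriple β hβ
  by_cases hαβ : α = β
  · subst hαβ
    refine ⟨⁅f α, ⁅f α, p⁆⁆, ?_, ?_⟩
    · obtain ⟨n, hn, -⟩ := ht.exists_nat_norm_sq hμ hp (hkill α hα) (hadj α hα)
      have : ⁅e α, ⁅f α, p⁆⁆ = (n : ℝ) • p := by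
        rw [leibniz_lie (e α), hkill α hα, lie_zero, add_zero, ht.lie_e_f, hμ, hn]
        rfl
      rw [sub_sub_cancel_left, this]
      exact S.neg_mem (S.smul_mem _ hpS)
    · rw [mCoeff, if_pos (Or.inl rfl)]
      exact ht.norm_lie_f_lie_f_le hμ hp (hkill α hα) (hadj α hα)
  -- the action of the brackets on `p`
  have hcross : ∀ γ ∈ P, ∀ δ ∈ P, γ ≠ δ →
      ⁅e δ, ⁅f γ, p⁆⁆ = 0 ∨ γ - δ ∈ P ∧ ⁅e δ, ⁅f γ, p⁆⁆ ∈ S := fun γ hγ δ hδ hne => by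
    rw [leibniz_lie, hkill δ hδ, lie_zero, add_zero]
    have hmem := lie_mem_rootSpace (hef.e_mem δ hδ) (hef.f_mem γ hγ)
    by_cases hz : ⁅e δ, f γ⁆ = 0
    · left; rw [hz, zero_lie]
    · have hroot : δ + -γ ∈ roots 𝔥 :=
        ⟨fun h0 => hne (by rw [← sub_eq_add_neg] at h0; exact (sub_eq_zero.1 h0).symm),
          fun h0 => hz (by rwa [h0, Submodule.mem_bot] at hmem)⟩
      rcases hP.pos_or_neg _ hroot with hpos | hneg
      · left; exact hhigh _ hpos _ hmem
      · right
        have heq : -(δ + -γ) = γ - δ := by abel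
        rw [heq] at hneg
        refine ⟨hneg, hS _ hneg _ ?_⟩
        rwa [← heq, neg_neg]
  have hff : ⁅⁅f β, f α⁆, p⁆ ∈ S := by
    have hmem := lie_mem_rootSpace (hef.f_mem β hβ) (hef.f_mem α hα)
    rw [show -β + -α = -(α + β) by abel] at hmem
    by_cases hz : ⁅f β, f α⁆ = 0
    · rw [hz, zero_lie]; exact S.zero_mem
    · by_cases hpos : α + β ∈ P
      · exact hS _ hpos _ hmem
      · have hroot : -(α + β) ∈ roots 𝔥 :=
          ⟨fun h0 => hP.not_pos_and_neg α hα (by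
            rw [neg_eq_zero] at h0; rwa [neg_eq_of_add_eq_zero_right h0]),
            fun h0 => hz (by rwa [h0, Submodule.mem_bot] at hmem)⟩
        rcases hP.pos_or_neg _ hroot with h1 | h1
        · rw [hhigh _ h1 _ hmem]; exact S.zero_mem
        · rw [neg_neg] at h1; exact absurd h1 hpos
  have hcrossS : ⁅e β, ⁅f α, p⁆⁆ ∈ S := by
    rcases hcross α hα β hβ hαβ with h0 | h0
    · rw [h0]; exact S.zero_mem
    · exact h0.2
  -- Modulo `S` the two orders of `f_α`, `f_β` agree, so either may be estimated.
  have hswap : ⁅f β, ⁅f α, p⁆⁆ = ⁅⁅f β, f α⁆, p⁆ + ⁅f α, ⁅f β, p⁆⁆ := leibniz_lie _ _ _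
  have hm0 : 0 ≤ mCoeff 𝔥 α β := by
    rw [mCoeff]; split_ifs <;> positivity
  by_cases hfα : ⁅f α, p⁆ = 0
  · refine ⟨0, ?_, by rw [norm_zero]; positivity⟩
    rw [hfα, lie_zero, lie_zero, sub_zero, sub_zero]; exact S.zero_mem
  by_cases hfβ : ⁅f β, p⁆ = 0
  · refine ⟨0, ?_, by rw [norm_zero]; positivity⟩
    rw [hswap, hfβ, lie_zero, add_zero, sub_zero]
    exact S.sub_mem hff hcrossS
  obtain ⟨a, ha⟩ := ht.exists_cartan_int ht'
  obtain ⟨b, hb⟩ := ht'.exists_cartan_int ht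
  suffices hgoal : (⁅e β, ⁅f α, p⁆⁆ = 0 ∧ 1 - (a : ℝ) ≤ mCoeff 𝔥 α β ^ 2) ∨
      (⁅e α, ⁅f β, p⁆⁆ = 0 ∧ 1 - (b : ℝ) ≤ mCoeff 𝔥 α β ^ 2) by
    have hm1 : 1 ≤ mCoeff 𝔥 α β := by
      rw [mCoeff]
      split_ifs
      · exact Real.one_le_sqrt.2 one_le_two
      · exact le_rfl
    rcases hgoal with ⟨hz, hma⟩ | ⟨hz, hmb⟩
    · refine ⟨_, ?_, ht.norm_lie_f_lie_f_le_of_lie_eq_zero ht' hμ hp (hkill β hβ) (hadj β hβ) hz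
        hfβ ha hm1 hma⟩
      rw [sub_sub_cancel_left]
      exact S.neg_mem hcrossS
    · refine ⟨⁅f α, ⁅f β, p⁆⁆, ?_, (ht'.norm_lie_f_lie_f_le_of_lie_eq_zero ht hμ hp (hkill α hα)
        (hadj α hα) hz hfα hb hm1 hmb).trans_eq (by ring)⟩
      rw [hswap, sub_sub, add_sub_add_right_eq_sub]
      exact S.sub_mem hff hcrossS
  obtain ⟨s, hs, hsa⟩ := ht.exists_mul_dualKilling ht'
  have hsa' : (a : ℝ) = s * dualKilling 𝔥 α β := by
    rw [ha] at hsa; exact_mod_cast hsa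
  obtain ⟨r, hr, hrr⟩ := ht.exists_pos_killingForm
  obtain ⟨r', hr', hrr'⟩ := ht'.exists_pos_killingForm
  have hab : (a : ℝ) * r = b * r' := by
    have := ht.apply_mul_killingForm ht'
    rw [ha, hb, hrr, hrr'] at this
    exact_mod_cast this
  -- Hence at least one of `e_β f_α p`, `e_α f_β p` vanishes.
  have hnot : ¬ (α - β ∈ P ∧ β - α ∈ P) := fun hh =>
    hP.not_pos_and_neg _ hh.1 (by rw [neg_sub]; exact hh.2)
  by_cases hD : dualKilling 𝔥 α β < 0
  · have hm : mCoeff 𝔥 α β ^ 2 = 2 := by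
      rw [mCoeff, if_pos (Or.inr hD), Real.sq_sqrt zero_le_two]
    have ha0 : (a : ℝ) < 0 := hsa' ▸ mul_neg_of_pos_of_neg hs hD
    have hb0 : (b : ℝ) < 0 := by
      by_contra! hcon
      have := mul_nonneg hcon hr'.le
      have := mul_neg_of_neg_of_pos ha0 hr
      linarith
    have ha0' : a < 0 := by exact_mod_cast ha0
    have hb0' : b < 0 := by exact_mod_cast hb0
    have hnot2 : ¬ (a ≤ -2 ∧ b ≤ -2) := fun ⟨h1, h2⟩ => by
      have h0 := ht.add_eq_zero_of_le ht' (a := a) (b := b) (by rw [ha]; simp) (by rw [hb]; simp)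
        (by exact_mod_cast h1) (by exact_mod_cast h2)
      exact hP.not_pos_and_neg α hα (by rwa [neg_eq_of_add_eq_zero_right h0])
    have hA : -1 ≤ a → 1 - (a : ℝ) ≤ mCoeff 𝔥 α β ^ 2 := fun h1 => by
      have : (-1 : ℝ) ≤ a := by exact_mod_cast h1
      rw [hm]; linarith
    have hB : -1 ≤ b → 1 - (b : ℝ) ≤ mCoeff 𝔥 α β ^ 2 := fun h1 => by
      have : (-1 : ℝ) ≤ b := by exact_mod_cast h1
      rw [hm]; linarith
    -- If both cross terms vanish, the order with Cartan integer `≥ -1` is taken. If only one does,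
    -- `±(α - β)` is a root, so `a = b = -1` and the forced order works.
    rcases hcross α hα β hβ hαβ with h1 | ⟨h1, -⟩
    · rcases hcross β hβ α hα (Ne.symm hαβ) with h2 | ⟨h2, -⟩
      · rcases le_or_gt (-1) a with h3 | h3
        · exact Or.inl ⟨h1, hA h3⟩
        · exact Or.inr ⟨h2, hB (by omega)⟩
      · obtain ⟨h'', ht''⟩ := htriple _ h2
        have := ht'.apply_coroot_eq_of_sub ht ht'' hb ha hb0' ha0'
        exact Or.inl ⟨h1, hA (by omega)⟩
    · obtain ⟨h'', ht''⟩ := htriple _ h1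
      have := ht.apply_coroot_eq_of_sub ht' ht'' ha hb ha0' hb0'
      rcases hcross β hβ α hα (Ne.symm hαβ) with h2 | ⟨h2, -⟩
      · exact Or.inr ⟨h2, hB (by omega)⟩
      · exact absurd ⟨h1, h2⟩ hnot
  · have hm : mCoeff 𝔥 α β ^ 2 = 1 := by
      rw [mCoeff, if_neg (by tauto), one_pow]
    have ha0 : 0 ≤ (a : ℝ) := hsa' ▸ mul_nonneg hs.le (not_lt.1 hD)
    have hb0 : 0 ≤ (b : ℝ) := nonneg_of_mul_nonneg_left (hab ▸ mul_nonneg ha0 hr.le) hr'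
    rcases hcross α hα β hβ hαβ with h1 | ⟨h1, -⟩
    · exact Or.inl ⟨h1, by rw [hm]; linarith⟩
    · rcases hcross β hβ α hα (Ne.symm hαβ) with h2 | ⟨h2, -⟩
      · exact Or.inr ⟨h2, by rw [hm]; linarith⟩
      · exact absurd ⟨h1, h2⟩ hnot

end HighestWeight

/-! ### The derivative of a smooth multiplicative map -/

section Derivative

variable {E : Type*} [NormedAddCommGroup E] [NormedSpace ℝ E]
  {K : Type*} [TopologicalSpace K] [ChartedSpace E K] [Group K]
  {A : Type*} [NormedRing A] [NormedAlgebra ℝ A] {ρ : K →* A}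

/-- The derivative at `1` of a multiplicative map to an algebra. -/
def derivOne (ρ : K →* A) : E →L[ℝ] A := mfderiv 𝓘(ℝ, E) 𝓘(ℝ, A) ρ 1

lemma hasFDerivAt_comp_extChartAt_symm (hρ : ContMDiff 𝓘(ℝ, E) 𝓘(ℝ, A) ∞ ρ) :
    HasFDerivAt (ρ ∘ (extChartAt 𝓘(ℝ, E) (1 : K)).symm) (derivOne (E := E) ρ)
      (extChartAt 𝓘(ℝ, E) (1 : K) 1) := by
  have h1 : HasMFDerivAt 𝓘(ℝ, E) 𝓘(ℝ, A) ρ 1 (mfderiv 𝓘(ℝ, E) 𝓘(ℝ, A) ρ 1) :=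
    (hρ.mdifferentiableAt (by simp)).hasMFDerivAt
  have h2 : HasFDerivWithinAt (ρ ∘ (extChartAt 𝓘(ℝ, E) (1 : K)).symm) (derivOne (E := E) ρ)
      (Set.range 𝓘(ℝ, E)) (extChartAt 𝓘(ℝ, E) (1 : K) 1) := h1.2
  exact h2.hasFDerivAt (by rw [ModelWithCorners.range_eq_univ]; exact Filter.univ_mem)

variable [LieGroup 𝓘(ℝ, E) ∞ K]

lemma contDiffOn_comp_extChartAt_symm (hρ : ContMDiff 𝓘(ℝ, E) 𝓘(ℝ, A) ∞ ρ) (g : K) :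
    ContDiffOn ℝ ∞ (ρ ∘ (extChartAt 𝓘(ℝ, E) g).symm) (extChartAt 𝓘(ℝ, E) g).target := by
  rw [← contMDiffOn_iff_contDiffOn]
  have : IsManifold 𝓘(ℝ, E) ∞ K := ContMDiffMul.toIsManifold
  exact hρ.comp_contMDiffOn (contMDiffOn_extChartAt_symm g)

/-- Every element of the Lie algebra is the velocity of a smooth curve of the image group. -/
lemma exists_curve (hρ : ContMDiff 𝓘(ℝ, E) 𝓘(ℝ, A) ∞ ρ) (x : E) :
    ∃ c : ℝ → K, c 0 = 1 ∧ ContDiff ℝ ∞ (fun t => ρ (c t)) ∧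
      HasDerivAt (fun t => ρ (c t)) (derivOne (E := E) ρ x) 0 := by
  set φ := extChartAt 𝓘(ℝ, E) (1 : K) with hφ
  have hopen : IsOpen φ.target := isOpen_extChartAt_target 1
  obtain ⟨r, hr, hball⟩ := Metric.isOpen_iff.1 hopen (φ 1) (mem_extChartAt_target 1)
  -- The sine keeps the curve in a ball of the chart for all times, with velocity `x` at `0`.
  set ε : ℝ := r / (‖x‖ + 1) with hε
  have hε0 : 0 < ε := by positivity
  set γ : ℝ → E := fun t => φ 1 + (ε * Real.sin (t / ε)) • x with hγ
  have hγs : ContDiff ℝ ∞ γ := by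
    refine contDiff_const.add (ContDiff.smul ?_ contDiff_const)
    exact contDiff_const.mul (Real.contDiff_sin.comp (contDiff_id.div_const ε))
  have hγmem : ∀ t, γ t ∈ φ.target := fun t => hball (by
    rw [mem_ball_iff_norm, hγ]
    simp only [add_sub_cancel_left]
    rw [norm_smul, Real.norm_eq_abs, abs_mul, abs_of_pos hε0]
    calc ε * |Real.sin (t / ε)| * ‖x‖ ≤ ε * 1 * ‖x‖ := by
          gcongr; exact Real.abs_sin_le_one _
      _ < ε * (‖x‖ + 1) := by nlinarith
      _ = r := by rw [hε]; field_simp)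
  have hγ0 : γ 0 = φ 1 := by simp [hγ]
  have hγd : HasDerivAt γ x 0 := by
    have h1 : HasDerivAt (fun t : ℝ => ε * Real.sin (t / ε)) 1 0 := by
      have := ((hasDerivAt_id (0 : ℝ)).div_const ε).sin.const_mul ε
      simpa [hε0.ne'] using this
    have h2 := (h1.smul_const x).const_add (φ 1)
    rwa [one_smul] at h2
  refine ⟨fun t => φ.symm (γ t), by simp [hγ0, hφ], ?_, ?_⟩
  · exact (contDiffOn_comp_extChartAt_symm hρ 1).comp_contDiff hγs hγmem
  · have h1 := hasFDerivAt_comp_extChartAt_symm hρ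
    rw [← hφ, ← hγ0] at h1
    exact h1.comp_hasDerivAt 0 hγd

/-- This is `ρ(g k) = ρ(g) ρ(k)` differentiated at `k = 1`. -/
lemma mfderiv_mulInvariantVectorField (hρ : ContMDiff 𝓘(ℝ, E) 𝓘(ℝ, A) ∞ ρ)
    (x : GroupLieAlgebra 𝓘(ℝ, E) K) (g : K) :
    mfderiv 𝓘(ℝ, E) 𝓘(ℝ, A) ρ g (mulInvariantVectorField x g) =
      ρ g * derivOne (E := E) ρ x := by
  have hd : ∀ k : K, MDifferentiableAt 𝓘(ℝ, E) 𝓘(ℝ, A) ρ k :=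
    fun k => hρ.mdifferentiableAt (by simp)
  have hmul : MDifferentiableAt 𝓘(ℝ, E) 𝓘(ℝ, E) (fun k : K => g * k) 1 :=
    (contMDiff_mul_left (I := 𝓘(ℝ, E)) (n := ∞)).mdifferentiableAt (by simp)
  have h1 : HasMFDerivAt 𝓘(ℝ, E) 𝓘(ℝ, A) (fun k => ρ (g * k)) 1
      ((mfderiv 𝓘(ℝ, E) 𝓘(ℝ, A) ρ (g * 1)).comp
        (mfderiv 𝓘(ℝ, E) 𝓘(ℝ, E) (fun k : K => g * k) 1)) :=
    (hd (g * 1)).hasMFDerivAt.comp 1 hmul.hasMFDerivAt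
  have h2 : HasMFDerivAt 𝓘(ℝ, E) 𝓘(ℝ, A) (fun k => ρ g * ρ k) 1
      ((ContinuousLinearMap.mul ℝ A (ρ g)).comp (derivOne (E := E) ρ)) :=
    (ContinuousLinearMap.mul ℝ A (ρ g)).hasMFDerivAt.comp (1 : K) (hd 1).hasMFDerivAt
  rw [show (fun k => ρ g * ρ k) = fun k => ρ (g * k) from funext fun k => (map_mul ρ g k).symm]
    at h2
  have h3 := congrArg (fun L : E →L[ℝ] A => L x) (hasMFDerivAt_unique h1 h2)
  rw [mul_one] at h3
  exact h3

open VectorField in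
/-- The derivative at `1` of a smooth multiplicative map preserves the brackets. -/
theorem derivOne_lie [CompleteSpace E] (hρ : ContMDiff 𝓘(ℝ, E) 𝓘(ℝ, A) ∞ ρ)
    (x y : GroupLieAlgebra 𝓘(ℝ, E) K) :
    derivOne (E := E) ρ (⁅x, y⁆ : GroupLieAlgebra 𝓘(ℝ, E) K) =
      derivOne (E := E) ρ x * derivOne (E := E) ρ y -
        derivOne (E := E) ρ y * derivOne (E := E) ρ x := by
  have : IsManifold 𝓘(ℝ, E) ∞ K := ContMDiffMul.toIsManifold
  have : IsManifold 𝓘(ℝ, E) 2 K := IsManifold.of_le (n := ∞) ENat.LEInfty.out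
  have : IsManifold 𝓘(ℝ, E) 1 K := IsManifold.of_le (n := ∞) ENat.LEInfty.out
  set φ := extChartAt 𝓘(ℝ, E) (1 : K) with hφ
  set G : E → A := ρ ∘ φ.symm with hG
  have hGd : HasFDerivAt G (derivOne (E := E) ρ) (φ 1) := hasFDerivAt_comp_extChartAt_symm hρ
  have hopen : IsOpen φ.target := isOpen_extChartAt_target 1
  have hmem : φ 1 ∈ φ.target := mem_extChartAt_target 1
  have hGs : ContDiffOn ℝ ∞ G φ.target := contDiffOn_comp_extChartAt_symm hρ 1
  -- the pulled back field
  set F : GroupLieAlgebra 𝓘(ℝ, E) K → E → E := fun z =>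
    mpullbackWithin 𝓘(ℝ, E) 𝓘(ℝ, E) φ.symm (mulInvariantVectorField z) (Set.range 𝓘(ℝ, E))
    with hF
  have hFd : ∀ z, DifferentiableAt ℝ (F z) (φ 1) := fun z => by
    have h1 : DifferentiableWithinAt ℝ (F z) (φ.symm ⁻¹' Set.univ ∩ Set.range 𝓘(ℝ, E)) (φ 1) :=
      MDifferentiableWithinAt.differentiableWithinAt_mpullbackWithin_vectorField
      (mdifferentiableAt_mulInvariantVectorField (I := 𝓘(ℝ, E)) z
        (g := (1 : K))).mdifferentiableWithinAt (s := Set.univ)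
    exact h1.differentiableAt (by
      rw [ModelWithCorners.range_eq_univ, Set.preimage_univ, Set.univ_inter]
      exact Filter.univ_mem)
  have hval : ∀ z, ∀ u ∈ φ.target, fderiv ℝ G u (F z u) = G u * derivOne (E := E) ρ z :=
    fun z u hu => by
      have hs : MDifferentiableWithinAt 𝓘(ℝ, E) 𝓘(ℝ, E) φ.symm (Set.range 𝓘(ℝ, E)) u :=
        mdifferentiableWithinAt_extChartAt_symm hu
      set L : E →L[ℝ] E := mfderivWithin 𝓘(ℝ, E) 𝓘(ℝ, E) φ.symm (Set.range 𝓘(ℝ, E)) u with hL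
      have hinv : L.IsInvertible := isInvertible_mfderivWithin_extChartAt_symm (I := 𝓘(ℝ, E)) hu
      set R : E →L[ℝ] A := mfderiv 𝓘(ℝ, E) 𝓘(ℝ, A) ρ (φ.symm u) with hR
      have hcomp : fderiv ℝ G u = R.comp L := by
        have h1 := (hρ.mdifferentiableAt (x := φ.symm u)
          (by simp)).hasMFDerivAt.comp_hasMFDerivWithinAt u hs.hasMFDerivWithinAt
        have h2 : HasFDerivWithinAt G (R.comp L) (Set.range 𝓘(ℝ, E)) u := h1.hasFDerivWithinAt
        exact (h2.hasFDerivAt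
          (by rw [ModelWithCorners.range_eq_univ]; exact Filter.univ_mem)).fderiv
      let Y : E := mulInvariantVectorField z (φ.symm u)
      have h3 : R Y = ρ (φ.symm u) * derivOne (E := E) ρ z :=
        mfderiv_mulInvariantVectorField hρ z (φ.symm u)
      have h4 : F z u = L.inverse Y := rfl
      rw [hcomp, h4, ContinuousLinearMap.comp_apply, hinv.self_apply_inverse, h3]
      rfl
  have h1 : G (φ 1) = 1 := by simp [hG, hφ]
  have hF1 : ∀ z, derivOne (E := E) ρ (F z (φ 1)) = derivOne (E := E) ρ z := fun z => by
    have := hval z _ hmem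
    rwa [hGd.fderiv, h1, one_mul] at this
  have hsecond : ∀ z w, fderiv ℝ (fun u => fderiv ℝ G u (F z u)) (φ 1) (F w (φ 1)) =
      derivOne (E := E) ρ w * derivOne (E := E) ρ z := fun z w => by
    have heq : (fun u => fderiv ℝ G u (F z u)) =ᶠ[nhds (φ 1)]
        fun u => G u * derivOne (E := E) ρ z :=
      Filter.eventuallyEq_of_mem (hopen.mem_nhds hmem) (hval z)
    rw [heq.fderiv_eq, (hGd.mul_const' _).fderiv, ← hF1 w]
    rfl
  -- The derivative `L` of the chart at `1`, which enters the definition of the bracket, cancels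
  -- because `dρ = dρ ∘ L`.
  have hbr : derivOne (E := E) ρ (⁅x, y⁆ : GroupLieAlgebra 𝓘(ℝ, E) K) =
      fderiv ℝ G (φ 1) (lieBracket ℝ (F x) (F y) (φ 1)) := by
    set L : E →L[ℝ] E := mfderiv 𝓘(ℝ, E) 𝓘(ℝ, E) φ 1 with hL
    have hinv : L.IsInvertible :=
      isInvertible_mfderiv_extChartAt (I := 𝓘(ℝ, E)) (mem_extChartAt_source (1 : K))
    have hφd : HasMFDerivAt 𝓘(ℝ, E) 𝓘(ℝ, E) φ 1 L :=
      (mdifferentiableAt_extChartAt (ChartedSpace.mem_chart_source (1 : K))).hasMFDerivAt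
    have hcomp : HasMFDerivAt 𝓘(ℝ, E) 𝓘(ℝ, A) (G ∘ φ) 1 ((derivOne (E := E) ρ).comp L) :=
      hGd.hasMFDerivAt.comp (1 : K) hφd
    have heq : ρ =ᶠ[nhds 1] G ∘ φ := by
      filter_upwards [extChartAt_source_mem_nhds (I := 𝓘(ℝ, E)) (1 : K)] with k hk
      exact (congrArg ρ (φ.left_inv hk)).symm
    have hfix : derivOne (E := E) ρ = (derivOne (E := E) ρ).comp L :=
      hasMFDerivAt_unique ((hρ.mdifferentiableAt (by simp)).hasMFDerivAt)
        (hcomp.congr_of_eventuallyEq heq)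
    have hdef : (⁅x, y⁆ : GroupLieAlgebra 𝓘(ℝ, E) K) = L.inverse (lieBracketWithin ℝ (F x) (F y)
        (φ.symm ⁻¹' Set.univ ∩ Set.range 𝓘(ℝ, E)) (φ 1)) := rfl
    rw [hdef, hGd.fderiv, ModelWithCorners.range_eq_univ, Set.preimage_univ, Set.univ_inter,
      lieBracketWithin_univ, hfix, ContinuousLinearMap.comp_apply, hinv.self_apply_inverse, ← hfix]
  rw [hbr, fderiv_apply_lieBracket (hGs.contDiffAt (hopen.mem_nhds hmem))
    (by rw [minSmoothness_of_isRCLikeNormedField]; exact ENat.LEInfty.out) (hFd y) (hFd x),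
    hsecond, hsecond]

end Derivative

/-! ### The second fundamental form of an orbit -/

section Orbit

variable {E : Type*} [NormedAddCommGroup E] [NormedSpace ℝ E]
  {K : Type*} [TopologicalSpace K] [ChartedSpace E K] [Group K] [LieGroup 𝓘(ℝ, E) ∞ K]
  {V : Type*} [NormedAddCommGroup V] [InnerProductSpace ℂ V] {ρ : K →* (V →L[ℂ] V)}

lemma IsIrreducibleUnitary.exists_curve (hρ : IsIrreducibleUnitary E ρ)
    (x : GroupLieAlgebra 𝓘(ℝ, E) K) (q : V) :
    ∃ c : ℝ → K, c 0 = 1 ∧ ContDiff ℝ ∞ (fun t => ρ (c t) q) ∧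
      HasDerivAt (fun t => ρ (c t) q) (differential E ρ x q) 0 := by
  obtain ⟨c, h0, hs, hd⟩ := HighestWeightOrbit.exists_curve hρ.smooth x
  let L : (V →L[ℂ] V) →L[ℝ] V := (ContinuousLinearMap.apply ℂ V q).restrictScalars ℝ
  exact ⟨c, h0, L.contDiff.comp hs, L.hasFDerivAt.comp_hasDerivAt 0 hd⟩

omit [LieGroup 𝓘(ℝ, E) ∞ K] in
lemma IsIrreducibleUnitary.real_inner_map (hρ : IsIrreducibleUnitary E ρ) (g : K) (v w : V) :
    inner ℝ (ρ g v) (ρ g w) = inner ℝ v w := by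
  rw [real_inner_eq_re_inner ℂ, real_inner_eq_re_inner ℂ, hρ.unitary]

lemma IsIrreducibleUnitary.inner_differential (hρ : IsIrreducibleUnitary E ρ)
    (x : GroupLieAlgebra 𝓘(ℝ, E) K) (v w : V) :
    inner ℂ (differential E ρ x v) w = -inner ℂ v (differential E ρ x w) := by
  obtain ⟨c, h0, hs, hd⟩ := HighestWeightOrbit.exists_curve hρ.smooth x
  let L : V → (V →L[ℂ] V) →L[ℝ] V := fun q =>
    (ContinuousLinearMap.apply ℂ V q).restrictScalars ℝ
  have hv : HasDerivAt (fun t => ρ (c t) v) (differential E ρ x v) 0 :=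
    (L v).hasFDerivAt.comp_hasDerivAt 0 hd
  have hw : HasDerivAt (fun t => ρ (c t) w) (differential E ρ x w) 0 :=
    (L w).hasFDerivAt.comp_hasDerivAt 0 hd
  have h1 := hv.inner ℂ hw
  simp only [hρ.unitary, h0, map_one, one_apply_eq_self] at h1
  have h2 := h1.unique (hasDerivAt_const 0 _)
  linear_combination h2

lemma differential_mem_tangentSpaceAt (hρ : IsIrreducibleUnitary E ρ)
    (x : GroupLieAlgebra 𝓘(ℝ, E) K) {p q : V} (hq : q ∈ orbit ρ p) :
    differential E ρ x q ∈ tangentSpaceAt (orbit ρ p) q := by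
  obtain ⟨c, h0, hs, hd⟩ := hρ.exists_curve x q
  refine Submodule.subset_span ⟨_, hs, fun s => ?_, by simp [h0], hd.deriv⟩
  obtain ⟨g, rfl⟩ := hq
  exact ⟨c s * g, congrArg (fun A : V →L[ℂ] V => A p) (map_mul ρ (c s) g)⟩

omit [TopologicalSpace K] [ChartedSpace E K] [LieGroup 𝓘(ℝ, E) ∞ K] in
lemma map_mem_tangentSpaceAt (g : K) {p q v : V} (hv : v ∈ tangentSpaceAt (orbit ρ p) q) :
    ρ g v ∈ tangentSpaceAt (orbit ρ p) (ρ g q) := by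
  let L : V →L[ℝ] V := (ρ g).restrictScalars ℝ
  change L v ∈ _
  have : tangentSpaceAt (orbit ρ p) q ≤ (tangentSpaceAt (orbit ρ p) (ρ g q)).comap
      L.toLinearMap := by
    refine Submodule.span_le.2 ?_
    rintro _ ⟨γ, hs, hm, h0, rfl⟩
    refine Submodule.subset_span ⟨fun t => ρ g (γ t), L.contDiff.comp hs, fun s => ?_, congrArg (ρ g) h0,
      ?_⟩
    · obtain ⟨k, hk⟩ := hm s
      refine ⟨g * k, (congrArg (fun A : V →L[ℂ] V => A p) (map_mul ρ g k)).trans ?_⟩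
      exact congrArg (ρ g) hk
    · have hd : HasDerivAt γ (deriv γ 0) 0 := (hs.differentiable (by simp) 0).hasDerivAt
      exact (L.hasFDerivAt.comp_hasDerivAt 0 hd).deriv
  exact this hv

variable [FiniteDimensional ℂ V]

/-- The derivative of a tangent field which vanishes at `p` is tangent. -/
lemma fderiv_mem_tangentSpaceAt (hρ : IsIrreducibleUnitary E ρ) {p : V} {Z : V → V}
    (hZs : ContDiff ℝ ∞ Z) (hZ : ∀ q ∈ orbit ρ p, Z q ∈ tangentSpaceAt (orbit ρ p) q)
    (hZp : Z p = 0) (x : GroupLieAlgebra 𝓘(ℝ, E) K) :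
    fderiv ℝ Z p (differential E ρ x p) ∈ tangentSpaceAt (orbit ρ p) p := by
  have : FiniteDimensional ℝ V := FiniteDimensional.complexToReal V
  rw [← Submodule.orthogonal_orthogonal (tangentSpaceAt (orbit ρ p) p), Submodule.mem_orthogonal]
  intro n hn
  obtain ⟨c, h0, hs, hd⟩ := HighestWeightOrbit.exists_curve hρ.smooth x
  let L : V → (V →L[ℂ] V) →L[ℝ] V := fun q =>
    (ContinuousLinearMap.apply ℂ V q).restrictScalars ℝ
  have hdp : HasDerivAt (fun t => ρ (c t) p) (differential E ρ x p) 0 :=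
    (L p).hasFDerivAt.comp_hasDerivAt 0 hd
  have hdn : HasDerivAt (fun t => ρ (c t) n) (differential E ρ x n) 0 :=
    (L n).hasFDerivAt.comp_hasDerivAt 0 hd
  have hp0 : ρ (c 0) p = p := by simp [h0]
  have hZd : HasFDerivAt Z (fderiv ℝ Z p) (ρ (c 0) p) := by
    rw [hp0]; exact (hZs.differentiable (by simp) p).hasFDerivAt
  -- `ρ(c t) n` stays normal along the orbit, so its product with `Z` is zero; in the derivative at
  -- `0` the term with `Z p = 0` drops out.
  have h1 := hdn.inner ℝ (hZd.comp_hasDerivAt 0 hdp)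
  have h2 : ∀ t, inner ℝ (ρ (c t) n) ((Z ∘ fun t => ρ (c t) p) t) = 0 := fun t => by
    rw [← hρ.real_inner_map (c t)⁻¹]
    have hcancel : ∀ v, ρ (c t)⁻¹ (ρ (c t) v) = v := fun v => by
      rw [← mul_apply_eq_comp, ← map_mul, inv_mul_cancel, map_one,
        one_apply_eq_self]
    have := map_mem_tangentSpaceAt (c t)⁻¹ (hZ (ρ (c t) p) ⟨c t, rfl⟩)
    rw [hcancel] at this ⊢
    rw [real_inner_comm]
    exact (Submodule.mem_orthogonal _ _).1 hn _ this
  simp only [h2] at h1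
  have h3 := h1.unique (hasDerivAt_const 0 _)
  simpa [h0, hZp] using h3

/-- The second fundamental form of an orbit on velocities of one-parameter groups is well defined,
and it is the normal component of `y x p`. -/
theorem exists_hasSecondFundamentalForm (hρ : IsIrreducibleUnitary E ρ) (p : V)
    (x y : GroupLieAlgebra 𝓘(ℝ, E) K) (u : V)
    (hu : differential E ρ y (differential E ρ x p) - u ∈
      tangentSpaceAt (orbit ρ p) p ⊔ Submodule.span ℝ {p}) :
    ∃ n, HasSecondFundamentalForm (orbit ρ p) p (differential E ρ x p) (differential E ρ y p) n ∧
      ‖n‖ ≤ ‖u‖ := by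
  have : FiniteDimensional ℝ V := FiniteDimensional.complexToReal V
  have hpo : p ∈ orbit ρ p := ⟨1, by simp⟩
  set S : Submodule ℝ V := tangentSpaceAt (orbit ρ p) p ⊔ Submodule.span ℝ {p} with hS
  let L : V →L[ℝ] V := (differential E ρ y).restrictScalars ℝ
  have hL : IsTangentExtension (orbit ρ p) p (differential E ρ y p) L :=
    ⟨L.contDiff, fun q hq => differential_mem_tangentSpaceAt hρ y hq, rfl⟩
  refine ⟨Sᗮ.starProjection u, ⟨differential_mem_tangentSpaceAt hρ x hpo,
    differential_mem_tangentSpaceAt hρ y hpo, Submodule.starProjection_apply_mem _ _, ⟨L, hL⟩,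
    fun W hW => ?_⟩, Submodule.norm_starProjection_apply_le _ _⟩
  -- Independence of the extension: `W - L` is tangent and vanishes at `p`.
  have h1 := fderiv_mem_tangentSpaceAt hρ (hW.contDiff.sub L.contDiff)
    (fun q hq => Submodule.sub_mem _ (hW.tangent q hq) (hL.tangent q hq))
    (by rw [hW.apply_eq]; exact sub_self _) x
  rw [fderiv_fun_sub (hW.contDiff.differentiable (by simp) p) L.differentiableAt, L.fderiv] at h1
  have h2 : u - Sᗮ.starProjection u ∈ S := by
    have := Submodule.sub_starProjection_mem_orthogonal (K := Sᗮ) u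
    rwa [Submodule.orthogonal_orthogonal] at this
  have h3 := S.add_mem (S.add_mem (le_sup_left (a := tangentSpaceAt (orbit ρ p) p) h1) hu) h2
  convert h3 using 1
  change _ = (fderiv ℝ W p (differential E ρ x p) - differential E ρ y (differential E ρ x p)) +
    _ + _
  abel

end Orbit

/-! ### The action of the complexified Lie algebra -/

section Action

variable {E : Type*} [NormedAddCommGroup E] [NormedSpace ℝ E] [CompleteSpace E]
  {K : Type*} [TopologicalSpace K] [ChartedSpace E K] [Group K] [LieGroup 𝓘(ℝ, E) ∞ K]
  {V : Type*} [NormedAddCommGroup V] [InnerProductSpace ℂ V] {ρ : K →* (V →L[ℂ] V)}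

omit [CompleteSpace E] [LieGroup 𝓘(ℝ, E) ∞ K] in
lemma complexAction_tmul (c : ℂ) (x : GroupLieAlgebra 𝓘(ℝ, E) K) :
    complexAction E ρ (c ⊗ₜ x) = c • differential E ρ x := by
  rw [complexAction, LinearMap.liftBaseChange_tmul]

lemma complexAction_lie (hρ : IsIrreducibleUnitary E ρ) (X Y : ComplexLieAlgebra E K) :
    complexAction E ρ ⁅X, Y⁆ =
      complexAction E ρ X * complexAction E ρ Y - complexAction E ρ Y * complexAction E ρ X := by
  induction X using TensorProduct.induction_on with
  | zero => simp
  | add X X' h h' => rw [add_lie, map_add, map_add, h, h', add_mul, mul_add]; abel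
  | tmul c x =>
    induction Y using TensorProduct.induction_on with
    | zero =>
      have h0 : ∀ X : ComplexLieAlgebra E K, ⁅X, (0 : ComplexLieAlgebra E K)⁆ = 0 :=
        fun X => lie_zero (L := ComplexLieAlgebra E K) (M := ComplexLieAlgebra E K) X
      rw [h0]; simp
    | add Y Y' h h' =>
      have h0 : ∀ X Y Y' : ComplexLieAlgebra E K, ⁅X, Y + Y'⁆ = ⁅X, Y⁆ + ⁅X, Y'⁆ :=
        fun X => lie_add (L := ComplexLieAlgebra E K) (M := ComplexLieAlgebra E K) X
      rw [h0, map_add, map_add, h, h', add_mul, mul_add]; abel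
    | tmul d y =>
      have h1 : differential E ρ ⁅x, y⁆ = differential E ρ x * differential E ρ y -
        differential E ρ y * differential E ρ x := derivOne_lie hρ.smooth x y
      rw [LieAlgebra.ExtendScalars.bracket_tmul, complexAction_tmul, complexAction_tmul,
        complexAction_tmul, h1, smul_mul_smul_comm, smul_mul_smul_comm, smul_sub, mul_comm d c]

/-- The representation of `𝔤` on `V`. -/
@[reducible] def lieRingModule (hρ : IsIrreducibleUnitary E ρ) :
    LieRingModule (ComplexLieAlgebra E K) V where
  bracket X v := complexAction E ρ X v
  add_lie X Y v := by simp
  lie_add X v w := by simp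
  leibniz_lie X Y v := by
    change complexAction E ρ X (complexAction E ρ Y v) = complexAction E ρ ⁅X, Y⁆ v +
      complexAction E ρ Y (complexAction E ρ X v)
    rw [complexAction_lie hρ]
    simp

lemma lieModule (hρ : IsIrreducibleUnitary E ρ) :
    letI := lieRingModule hρ
    LieModule ℂ (ComplexLieAlgebra E K) V :=
  letI := lieRingModule hρ
  { smul_lie := fun c X v => by
      change complexAction E ρ (c • X) v = c • complexAction E ρ X v
      simp
    lie_smul := fun c X v => by
      change complexAction E ρ X (c • v) = c • complexAction E ρ X v
      simp }

omit [CompleteSpace E] in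
lemma inner_complexAction (hρ : IsIrreducibleUnitary E ρ) {X : ComplexLieAlgebra E K}
    (hX : X ∈ realForm E K) (v w : V) :
    inner ℂ (complexAction E ρ X v) w = -inner ℂ v (complexAction E ρ X w) := by
  obtain ⟨x, rfl⟩ := hX
  rw [complexAction_tmul, one_smul]
  exact hρ.inner_differential x v w

/-- The complex conjugation of `𝔤` with respect to `𝔨`. -/
def conjugation (E K : Type*) [NormedAddCommGroup E] [NormedSpace ℝ E] [TopologicalSpace K]
    [ChartedSpace E K] [Group K] : ComplexLieAlgebra E K →ₗ[ℝ] ComplexLieAlgebra E K :=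
  TensorProduct.map Complex.conjLIE.toLinearEquiv.toLinearMap LinearMap.id

omit [CompleteSpace E] [LieGroup 𝓘(ℝ, E) ∞ K] in
lemma conjugation_tmul (c : ℂ) (x : GroupLieAlgebra 𝓘(ℝ, E) K) :
    conjugation E K (c ⊗ₜ x) = (starRingEnd ℂ c) ⊗ₜ x := rfl

omit [CompleteSpace E] [LieGroup 𝓘(ℝ, E) ∞ K] in
lemma conjugation_smul (c : ℂ) (X : ComplexLieAlgebra E K) :
    conjugation E K (c • X) = starRingEnd ℂ c • conjugation E K X := by
  induction X using TensorProduct.induction_on with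
  | zero => simp
  | add X X' h h' => rw [smul_add, map_add, h, h', map_add, smul_add]
  | tmul d x => simp [TensorProduct.smul_tmul', conjugation_tmul]

lemma conjugation_lie (X Y : ComplexLieAlgebra E K) :
    conjugation E K ⁅X, Y⁆ = ⁅conjugation E K X, conjugation E K Y⁆ := by
  induction X using TensorProduct.induction_on with
  | zero => simp
  | add X X' h h' => rw [add_lie, map_add, map_add, h, h', add_lie]
  | tmul c x =>
    induction Y using TensorProduct.induction_on with
    | zero =>
      have h0 : ∀ X : ComplexLieAlgebra E K, ⁅X, (0 : ComplexLieAlgebra E K)⁆ = 0 :=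
        fun X => lie_zero (L := ComplexLieAlgebra E K) (M := ComplexLieAlgebra E K) X
      rw [h0, map_zero, h0]
    | add Y Y' h h' =>
      have h0 : ∀ X Y Y' : ComplexLieAlgebra E K, ⁅X, Y + Y'⁆ = ⁅X, Y⁆ + ⁅X, Y'⁆ :=
        fun X => lie_add (L := ComplexLieAlgebra E K) (M := ComplexLieAlgebra E K) X
      rw [h0, map_add, map_add, h, h', h0]
    | tmul d y => simp [conjugation_tmul]

omit [CompleteSpace E] [LieGroup 𝓘(ℝ, E) ∞ K] in
lemma add_conjugation_mem_realForm (X : ComplexLieAlgebra E K) :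
    X + conjugation E K X ∈ realForm E K := by
  induction X using TensorProduct.induction_on with
  | zero => exact ⟨0, by simp⟩
  | add X X' h h' =>
    obtain ⟨a, ha⟩ := h
    obtain ⟨b, hb⟩ := h'
    refine ⟨a + b, ?_⟩
    simp only at ha hb ⊢
    rw [TensorProduct.tmul_add, ha, hb, map_add]
    abel
  | tmul c x =>
    refine ⟨(2 * c.re) • x, ?_⟩
    simp only
    rw [conjugation_tmul, ← TensorProduct.add_tmul, Complex.add_conj, TensorProduct.tmul_smul,
      TensorProduct.smul_tmul']
    simp

omit [CompleteSpace E] in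
lemma im_eigenvalue (hρ : IsIrreducibleUnitary E ρ) {X : ComplexLieAlgebra E K}
    (hX : X ∈ realForm E K) {v : V} (hv : v ≠ 0) {c : ℂ} (hc : complexAction E ρ X v = c • v) :
    starRingEnd ℂ c = -c := by
  have := inner_complexAction hρ hX v v
  rw [hc, inner_smul_left, inner_smul_right, ← neg_mul] at this
  exact mul_right_cancel₀ (inner_self_ne_zero.2 hv) this

/-- The negative root vectors map the highest weight vector to a tangent vector of the orbit. -/
lemma complexAction_mem_tangentSpaceAt (hρ : IsIrreducibleUnitary E ρ) {T : Subgroup K}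
    {P : Set (Module.Dual ℂ (cartan E T))} {μ : Module.Dual ℂ (cartan E T)} {p : V}
    (hp : IsHighestWeightVector (cartan E T) P (fun x v => complexAction E ρ x v) μ p)
    {γ : Module.Dual ℂ (cartan E T)} (hγ : γ ∈ P) {z : ComplexLieAlgebra E K}
    (hz : z ∈ rootSpace (cartan E T) (-γ)) :
    complexAction E ρ z p ∈ tangentSpaceAt (orbit ρ p) p := by
  by_cases hzp : complexAction E ρ z p = 0
  · rw [hzp]; exact Submodule.zero_mem _
  -- `μ(k)` and `μ(k) - γ(k)` are both eigenvalues of `k` on `V`, as `z p ≠ 0`, hence both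
  -- imaginary.
  have himag : ∀ k : cartan E T, (k : ComplexLieAlgebra E K) ∈ realForm E K →
      starRingEnd ℂ (γ k) = -γ k := fun k hk => by
    have h1 := im_eigenvalue hρ hk hp.ne_zero (hp.weight k)
    have h2 : complexAction E ρ (k : ComplexLieAlgebra E K) (complexAction E ρ z p) =
        (μ k - γ k) • complexAction E ρ z p := by
      have h3 : complexAction E ρ ⁅(k : ComplexLieAlgebra E K), z⁆ p =
          complexAction E ρ k (complexAction E ρ z p) -
            complexAction E ρ z (complexAction E ρ k p) := by
        rw [complexAction_lie hρ]; rfl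
      have h4 : complexAction E ρ (k : ComplexLieAlgebra E K) p = μ k • p := hp.weight k
      have h5 : complexAction E ρ ((-γ) k • z) p = (-γ) k • complexAction E ρ z p := by
        rw [map_smul]; rfl
      rw [hz k, h5, h4, map_smul, eq_sub_iff_add_eq, ← add_smul] at h3
      rw [← h3, LinearMap.neg_apply, neg_add_eq_sub]
    have h3 := im_eigenvalue hρ hk hzp h2
    rw [map_sub, h1] at h3
    linear_combination -h3
  -- `γ` is imaginary on `𝔱`, so conjugation turns the weight `-γ` into `γ`; it suffices to check
  -- this on `𝔱`, which spans `𝔥`.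
  have hconj : conjugation E K z ∈ rootSpace (cartan E T) γ := by
    rintro ⟨k, hk⟩
    have hspan : cartan E T = Submodule.span ℂ ((lieAlgebraOf E T).map
      (TensorProduct.mk ℝ ℂ (GroupLieAlgebra 𝓘(ℝ, E) K) 1)) := Submodule.baseChange_eq_span _ _
    have hk0 := hk
    rw [hspan] at hk0
    revert hk
    induction hk0 using Submodule.span_induction with
    | mem k hk' =>
      intro hmem
      obtain ⟨x, hx, rfl⟩ := hk'
      have hreal : ((1 : ℂ) ⊗ₜ[ℝ] x : ComplexLieAlgebra E K) ∈ realForm E K := ⟨x, rfl⟩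
      have h1 := congrArg (conjugation E K) (hz ⟨_, hmem⟩)
      rw [conjugation_lie, conjugation_smul, LinearMap.neg_apply, map_neg, himag _ hreal, neg_neg]
        at h1
      have h2 : conjugation E K (TensorProduct.mk ℝ ℂ (GroupLieAlgebra 𝓘(ℝ, E) K) 1 x) =
          TensorProduct.mk ℝ ℂ (GroupLieAlgebra 𝓘(ℝ, E) K) 1 x := by
        rw [TensorProduct.mk_apply, conjugation_tmul, map_one]
      exact (congrArg (fun X => ⁅X, conjugation E K z⁆) h2).symm.trans h1
    | zero =>
      intro _
      change ⁅(0 : ComplexLieAlgebra E K), _⁆ = γ 0 • _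
      rw [zero_lie, map_zero, zero_smul]
    | add k k' hk hk' h h' =>
      intro _
      change ⁅k + k', _⁆ = γ (⟨k, hspan.ge hk⟩ + ⟨k', hspan.ge hk'⟩) • _
      rw [add_lie, map_add, add_smul]
      exact congrArg₂ _ (h _) (h' _)
    | smul c k hk h =>
      intro _
      change ⁅c • k, _⁆ = γ (c • ⟨k, hspan.ge hk⟩) • _
      rw [map_smul, smul_assoc]
      exact (smul_lie (R := ℂ) (L := ComplexLieAlgebra E K) (M := ComplexLieAlgebra E K) c k
        (conjugation E K z)).trans (congrArg _ (h _))
  have hzero : complexAction E ρ (conjugation E K z) p = 0 := hp.highest γ hγ _ hconj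
  -- The conjugate of `z` kills `p`, so `z` acts on `p` as an element of `𝔨`.
  obtain ⟨a, ha⟩ := add_conjugation_mem_realForm z
  have heq : complexAction E ρ z p = differential E ρ a p := by
    have h1 := congrArg (fun X => complexAction E ρ X p) ha
    simp only [complexAction_tmul, one_smul, map_add, add_apply, hzero,
      add_zero] at h1
    exact h1.symm
  rw [heq]
  exact differential_mem_tangentSpaceAt hρ a ⟨1, by simp⟩

end Action

end

end HighestWeightOrbit

/-! ### The estimate for the orbit of the highest weight vector. -/

theorem mainTheorem3
    {E : Type*} [NormedAddCommGroup E] [NormedSpace ℝ E] [FiniteDimensional ℝ E]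
    {K : Type*} [TopologicalSpace K] [ChartedSpace E K] [Group K]
    [LieGroup 𝓘(ℝ, E) ∞ K] [CompactSpace K]
    {V : Type*} [NormedAddCommGroup V] [InnerProductSpace ℂ V] [FiniteDimensional ℂ V]
    (ρ : K →* (V →L[ℂ] V)) (hρ : HighestWeightOrbit.IsIrreducibleUnitary E ρ)
    (T : Subgroup K) (hT : HighestWeightOrbit.IsMaximalTorus T)
    (P : Set (Module.Dual ℂ (HighestWeightOrbit.cartan E T)))
    (hP : HighestWeightOrbit.IsPositiveSystem (HighestWeightOrbit.cartan E T) P)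
    (e f : Module.Dual ℂ (HighestWeightOrbit.cartan E T) →
      HighestWeightOrbit.ComplexLieAlgebra E K)
    (hef : HighestWeightOrbit.IsRootVectorSystem (HighestWeightOrbit.cartan E T)
      (HighestWeightOrbit.realForm E K) P e f)
    (μ : Module.Dual ℂ (HighestWeightOrbit.cartan E T)) (p : V)
    (hp : HighestWeightOrbit.IsHighestWeightVector (HighestWeightOrbit.cartan E T) P
      (fun x v => HighestWeightOrbit.complexAction E ρ x v) μ p)
    (hp1 : ‖p‖ = 1)
    (α : Module.Dual ℂ (HighestWeightOrbit.cartan E T)) (hα : α ∈ P)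
    (β : Module.Dual ℂ (HighestWeightOrbit.cartan E T)) (hβ : β ∈ P) :
    ∃ n : V,
      HighestWeightOrbit.HasSecondFundamentalForm (HighestWeightOrbit.orbit ρ p) p
        (HighestWeightOrbit.complexAction E ρ (f α) p)
        (HighestWeightOrbit.complexAction E ρ (f β) p) n ∧
      ‖n‖ ≤ HighestWeightOrbit.mCoeff (HighestWeightOrbit.cartan E T) α β *
        ‖HighestWeightOrbit.complexAction E ρ (f α) p‖ *
        ‖HighestWeightOrbit.complexAction E ρ (f β) p‖ := by
  have : CompleteSpace E := FiniteDimensional.complete ℝ E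
  have : FiniteDimensional ℝ (GroupLieAlgebra 𝓘(ℝ, E) K) := inferInstanceAs (FiniteDimensional ℝ E)
  have : FiniteDimensional ℂ (HighestWeightOrbit.ComplexLieAlgebra E K) :=
    inferInstanceAs (Module.Finite ℂ (ℂ ⊗[ℝ] GroupLieAlgebra 𝓘(ℝ, E) K))
  let := HighestWeightOrbit.lieRingModule hρ
  have := HighestWeightOrbit.lieModule hρ
  obtain ⟨u, hu, hbound⟩ := HighestWeightOrbit.exists_sub_mem_norm_le (V := V) hP hef
    (fun x hx => HighestWeightOrbit.inner_complexAction hρ hx) hp.weight hp.highest hp1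
    (HighestWeightOrbit.tangentSpaceAt (HighestWeightOrbit.orbit ρ p) p ⊔ Submodule.span ℝ {p})
    (le_sup_right (a := HighestWeightOrbit.tangentSpaceAt (HighestWeightOrbit.orbit ρ p) p)
      (Submodule.mem_span_singleton_self p))
    (fun γ hγ z hz => le_sup_left
      (a := HighestWeightOrbit.tangentSpaceAt (HighestWeightOrbit.orbit ρ p) p)
      (HighestWeightOrbit.complexAction_mem_tangentSpaceAt hρ hp hγ hz)) hα hβ
  -- `f p` is the velocity of the element `f - e` of `𝔨`
  have hvel : ∀ γ ∈ P, ∃ a : GroupLieAlgebra 𝓘(ℝ, E) K,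
      (∀ v, HighestWeightOrbit.differential E ρ a v =
        HighestWeightOrbit.complexAction E ρ (f γ) v -
          HighestWeightOrbit.complexAction E ρ (e γ) v) ∧
      HighestWeightOrbit.differential E ρ a p =
        HighestWeightOrbit.complexAction E ρ (f γ) p := by
    intro γ hγ
    obtain ⟨a, ha⟩ := hef.x_mem γ hγ
    have h1 : ∀ v, HighestWeightOrbit.differential E ρ (-a) v =
        HighestWeightOrbit.complexAction E ρ (f γ) v -
          HighestWeightOrbit.complexAction E ρ (e γ) v := fun v => by
      have h2 := congrArg (fun X => HighestWeightOrbit.complexAction E ρ X v) ha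
      simp only [HighestWeightOrbit.complexAction_tmul, one_smul, map_sub, sub_apply] at h2
      rw [map_neg, neg_apply, h2, neg_sub]
    refine ⟨-a, h1, ?_⟩
    have h3 : HighestWeightOrbit.complexAction E ρ (e γ) p = 0 :=
      hp.highest γ hγ _ (hef.e_mem γ hγ)
    rw [h1, h3, sub_zero]
  obtain ⟨a, -, ha⟩ := hvel α hα
  obtain ⟨b, hb, hb'⟩ := hvel β hβ
  obtain ⟨n, hn, hnu⟩ := HighestWeightOrbit.exists_hasSecondFundamentalForm hρ p a b u (by
    rw [ha, hb]; exact hu)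
  rw [ha, hb'] at hn
  exact ⟨n, hn, hnu.trans hbound⟩
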